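/- Let $T\ge 1$ be an integer, $\alpha>0$ and $L>1/\sqrt T$. Let $\mathcal H(L,\alpha)$ be the set of functions $f:[0,1]\to[0,1]$ that attain their maximum $M(f)$ at some point $x^\star\in[0,1]$ such that $|f(x^\star)-f(x)|\le L|x^\star-x|^\alpha$ for all $x\in[0,1]$. In the continuum-armed bandit problem with mean-payoff function $f$, the player chooses at each round $t=1,\dots,T$ an arm $X_t\in[0,1]$ and receives a reward $Y_t$ which, given $X_t$, is independent of the past, has mean $f(X_t)$, and has $(1/4)$-subgaussian noise, i.e. $\mathbb E[e^{s(Y_t-f(X_t))}\mid X_t]\le e^{s^2/8}$ for all $s\in\mathbb R$. The regret is $\overline R_T=T\,M(f)-\mathbb E\big[\sum_{t=1}^T Y_t\big]$. Put $K^\star=\min\big(\lceil L^{2/(2\alpha+1)}T^{1/(2\alpha+1)}\rceil,\,T\big)$, and let $\pi_i$ be the uniform distribution on $[(i-1)/K^\star,i/K^\star]$ for $1\le i\le K^\star$. Algorithm CAB1.1 with these distributions and a $K^\star$-armed bandit algorithm $\mathcal A$ proceeds as follows: at each round $t$, $\mathcal A$ selects $I_t\in\{1,\dots,K^\star\}$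 on the basis of $I_1,Y_1,\dots,I_{t-1},Y_{t-1}$; the arm $X_t$ is drawn from $\pi_{I_t}$; and the reward $Y_t$ is given to $\mathcal A$ as the reward of $I_t$. Let $\mathcal A$ be MOSS with horizon $T$: at each round it selects, with ties broken arbitrarily (possibly at random), an index $i$ maximizing $$\hat\mu_i+\sqrt{\frac{c}{N_i}\,\max\Big(\log\frac{T}{K^\star N_i},\,0\Big)},$$ where $N_i$ is the number of past selections of $i$ and $\hat\mu_i$ is the average of the rewards then received (the quantity being $+\infty$ if $N_i=0$). Here $c$ is one of the two usual normalizations $c=1$ and $c=1/2$. Then $$\sup_{f\in\mathcal H(L,\alpha)}\overline R_T\;\le\;28\,L^{1/(2\alpha+1)}\,T^{(\alpha+1)/(2\alpha+1)},$$ whatever the reward distributions with the above properties. -/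

import Mathlib

open MeasureTheory ProbabilityTheory
open scoped unitInterval NNReal

namespace CAB

/-- The class `H(L, α)`: functions from `[0,1]` to `[0,1]` that attain their maximum `M(f)` at some
point around which they satisfy a one-point Hölder condition. -/
def holderClass (L α : ℝ) : Set (I → ℝ) :=
  {f | (∀ x, f x ∈ Set.Icc (0 : ℝ) 1) ∧
    ∃ xs : I, f xs = ⨆ x, f x ∧ ∀ x : I, |f xs - f x| ≤ L * |(xs : ℝ) - (x : ℝ)| ^ α}

/-- `ν t x` is the law of the reward `Y_t` given `X_t = x`. The reward has conditional mean `f x`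
and its noise `Y_t - f x` is conditionally `(1/4)`-subgaussian (variance proxy `1/4`, that is
`E exp (s (Y_t - f x)) ≤ exp (s² / 8)`). -/
structure IsRewardModel (f : I → ℝ) (ν : ℕ → Kernel I ℝ) : Prop where
  markov : ∀ t, IsMarkovKernel (ν t)
  mean : ∀ t x, ∫ y, y ∂(ν t x) = f x
  subgaussian : ∀ t x, HasSubgaussianMGF (fun y => y - f x) (1 / 4 : ℝ≥0) (ν t x)

/-- The uniform distribution over the `i`-th (counting from `0`) interval `[i / K, (i + 1) / K]`. -/
noncomputable def uniformCell (K : ℕ) (i : Fin K) : Measure I :=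
  cond volume {x : I | (i : ℝ) / K ≤ (x : ℝ) ∧ (x : ℝ) ≤ ((i : ℝ) + 1) / K}

/-- A (possibly randomized) algorithm for `K`-armed bandits: the law of the next arm, as a function
of the arms played and of the rewards received so far. -/
structure FiniteAlgorithm (K : ℕ) where
  policy : (t : ℕ) → Kernel (Fin t → Fin K × ℝ) (Fin K)
  markov : ∀ t, IsMarkovKernel (policy t)

section MOSS

variable {K t : ℕ}

/-- The number of times that arm `i` was played. -/
def pulls (h : Fin t → Fin K × ℝ) (i : Fin K) : ℕ :=
  (Finset.univ.filter fun s => (h s).1 = i).card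

/-- The average of the rewards received when arm `i` was played. -/
noncomputable def empMean (h : Fin t → Fin K × ℝ) (i : Fin K) : ℝ :=
  (∑ s ∈ Finset.univ.filter (fun s => (h s).1 = i), (h s).2) / pulls h i

/-- The MOSS index with horizon `T` and exploration constant `c`: with `N` the number of plays of
arm `i`, it is the empirical mean plus `√(c * max (log (T / (K N))) 0 / N)`, and `∞` if `N = 0`. -/
noncomputable def mossIndex (c : ℝ) (T : ℕ) (h : Fin t → Fin K × ℝ) (i : Fin K) : EReal :=
  if pulls h i = 0 then ⊤
  else ((empMean h i +
    √(c * max (Real.log ((T : ℝ) / (K * pulls h i))) 0 / pulls h i) : ℝ) : EReal)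

end MOSS

/-- `A` is MOSS run for `T` rounds: at each round it plays an arm with maximal index. Ties are
broken in an arbitrary, possibly randomized way. -/
def IsMOSS (c : ℝ) (T : ℕ) {K : ℕ} (A : FiniteAlgorithm K) : Prop :=
  ∀ t < T, ∀ h : Fin t → Fin K × ℝ,
    A.policy t h {i | ∀ j, mossIndex c T h j ≤ mossIndex c T h i} = 1

section Interaction

variable {K : ℕ}

/-- What the finite-armed algorithm gets to see of a history of triples `(I_s, X_s, Y_s)`. -/
def observed {t : ℕ} (h : Fin t → Fin K × I × ℝ) : Fin t → Fin K × ℝ :=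
  fun s => ((h s).1, (h s).2.2)

lemma measurable_observed {t : ℕ} : Measurable (observed (K := K) (t := t)) := by
  unfold observed
  fun_prop

/-- One round of CAB1.1, given the history: the finite-armed algorithm chooses `I_t`, then `X_t` is
drawn from `π (I_t)`, then `Y_t` is drawn from `ν t (X_t)`. -/
noncomputable def roundKernel (A : FiniteAlgorithm K) (π : Fin K → Measure I)
    (ν : ℕ → Kernel I ℝ) (t : ℕ) : Kernel (Fin t → Fin K × I × ℝ) (Fin K × I × ℝ) :=
  ((A.policy t).comap observed measurable_observed) ⊗ₖ
    Kernel.prodMkLeft (Fin t → Fin K × I × ℝ)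
      (Kernel.ofFunOfCountable π ⊗ₖ Kernel.prodMkLeft (Fin K) (ν t))

/-- The law of the first `t` triples `(I_s, X_s, Y_s)` when CAB1.1 is run with the distributions
`π` and the finite-armed algorithm `A` against the reward laws `ν`. -/
noncomputable def cabLaw (A : FiniteAlgorithm K) (π : Fin K → Measure I)
    (ν : ℕ → Kernel I ℝ) : (t : ℕ) → Measure (Fin t → Fin K × I × ℝ)
  | 0 => Measure.dirac Fin.elim0
  | t + 1 => ((cabLaw A π ν t) ⊗ₘ (roundKernel A π ν t)).map
      (fun p => (Fin.snoc p.1 p.2 : Fin (t + 1) → Fin K × I × ℝ))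

/-- The regret at time `T`, `T M(f) - E [∑ Y_t]`, of CAB1.1. -/
noncomputable def cabRegret (A : FiniteAlgorithm K) (π : Fin K → Measure I) (f : I → ℝ)
    (ν : ℕ → Kernel I ℝ) (T : ℕ) : ℝ :=
  T * (⨆ x, f x) - ∫ h, ∑ s, (h s).2.2 ∂(cabLaw A π ν T)

end Interaction

/-- The number of cells `K⋆ = min (⌈L ^ (2 / (2 α + 1)) T ^ (1 / (2 α + 1))⌉, T)`. -/
noncomputable def cellCount (L α : ℝ) (T : ℕ) : ℕ :=
  min ⌈L ^ (2 / (2 * α + 1)) * (T : ℝ) ^ (1 / (2 * α + 1))⌉₊ T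

end CAB

/-! Put b = M(f) - L K^(-α). The Hölder condition at the maximizer gives f ≥ b on a whole cell
containing it, so replacing M(f) by b costs T L K^(-α), and the rest is a distribution-free bound 10
√(KT) for MOSS against b (`sum_lintegral_gap_moss_le`). The scale x = L^(2/(2α+1)) T^(1/(2α+1))
balances the two terms: T L x^(-α) and √(xT) both equal B = L^(1/(2α+1)) T^((α+1)/(2α+1)). If x < T,
then K = ⌈x⌉ ≤ 2x and the total is at most 16 B; otherwise the trivial bound T ≤ B suffices.

The reward of an arm of MOSS mixes the noise with the randomness of X_t, so its variance proxy
around its mean is 1/4 + 1/4 = 1/2. The lower tail of the reference arm is however measured around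
b, below every payoff of its cell, and there the noise alone counts, with proxy 1/4. The peeling
below relies on this sharper proxy when c = 1/2.

Since the played arm j maximizes the index, b - m_j is at most the overestimation of m_j by the
index of j plus the underestimation of b by the index of the reference arm. With r = T/K,
overestimations are summed over the successive plays of each arm: the first play costs 1, the
bonuses 4√r, the excess deviations √r. Underestimation is bounded by 2/√r at each fixed time, by
peeling the random number of plays into blocks of ratio 4. Both bounds use the supermartingale exp(l
D - l² v N / 2) (`lintegral_expWeight_add_le`) and the inequality x ≤ exp(kx - 1)/k, which turns
exponential moments into bounds on expected positive parts without integrating tails. -/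

namespace CAB

/-! ### The law of the interaction and the decomposition of the regret into gaps -/

section CabLaw

variable {K : ℕ}

/-- The law of the pair `(X_t, Y_t)` given that arm `j` is played. -/
noncomputable def armLaw (π : Fin K → Measure I) (ν : ℕ → Kernel I ℝ) (t : ℕ) (j : Fin K) :
    Measure (I × ℝ) := π j ⊗ₘ ν t

lemma measurable_snoc_pair {α : Type*} [MeasurableSpace α] {t : ℕ} :
    Measurable (fun p : (Fin t → α) × α => (Fin.snoc p.1 p.2 : Fin (t + 1) → α)) := by
  refine measurable_pi_iff.2 fun i => ?_
  refine Fin.lastCases ?_ (fun i => ?_) i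
  · simpa using measurable_snd
  · simp only [Fin.snoc_castSucc]
    fun_prop

lemma observed_snoc {t : ℕ} (h : Fin t → Fin K × I × ℝ) (z : Fin K × I × ℝ) :
    observed (Fin.snoc h z : Fin (t + 1) → Fin K × I × ℝ) =
      (Fin.snoc (observed h) (z.1, z.2.2) : Fin (t + 1) → Fin K × ℝ) := by
  funext i
  refine Fin.lastCases ?_ (fun i => ?_) i <;> simp [observed]

lemma isMarkovKernel_ofFunOfCountable {π : Fin K → Measure I}
    (hπ : ∀ i, IsProbabilityMeasure (π i)) :
    IsMarkovKernel (Kernel.ofFunOfCountable π) := ⟨hπ⟩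

lemma measurable_policy (A : FiniteAlgorithm K) (t : ℕ) (j : Fin K) :
    Measurable fun h : Fin t → Fin K × I × ℝ => A.policy t (observed h) {j} :=
  ((A.policy t).measurable_coe (measurableSet_singleton j)).comp measurable_observed

variable (A : FiniteAlgorithm K) (π : Fin K → Measure I) (ν : ℕ → Kernel I ℝ)
  [hπ : ∀ i, IsProbabilityMeasure (π i)] [hν : ∀ t, IsMarkovKernel (ν t)]

instance isProbabilityMeasure_armLaw (t : ℕ) (j : Fin K) :
    IsProbabilityMeasure (armLaw π ν t j) := by
  unfold armLaw; infer_instance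

instance isMarkovKernel_roundKernel (t : ℕ) : IsMarkovKernel (roundKernel A π ν t) := by
  have := A.markov t
  have := isMarkovKernel_ofFunOfCountable hπ
  unfold roundKernel
  infer_instance

instance isProbabilityMeasure_cabLaw (t : ℕ) : IsProbabilityMeasure (cabLaw A π ν t) := by
  induction t with
  | zero => unfold cabLaw; infer_instance
  | succ t ih =>
    unfold cabLaw
    exact Measure.isProbabilityMeasure_map measurable_snoc_pair.aemeasurable

lemma lintegral_roundKernel (t : ℕ) (h : Fin t → Fin K × I × ℝ) {F : Fin K × I × ℝ → ENNReal}
    (hF : Measurable F) :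
    ∫⁻ z, F z ∂(roundKernel A π ν t h) =
      ∑ j, A.policy t (observed h) {j} * ∫⁻ w, F (j, w) ∂(armLaw π ν t j) := by
  have := A.markov t
  have := isMarkovKernel_ofFunOfCountable hπ
  unfold roundKernel
  rw [Kernel.lintegral_compProd _ _ _ hF, lintegral_fintype]
  refine Finset.sum_congr rfl fun j _ => ?_
  rw [mul_comm]
  congr 1
  have hFj : Measurable fun w => F (j, w) := hF.comp measurable_prodMk_left
  rw [armLaw, Measure.lintegral_compProd hFj, Kernel.prodMkLeft_apply,
    Kernel.lintegral_compProd _ _ _ hFj]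
  rfl

lemma roundKernel_eq_sum (t : ℕ) (h : Fin t → Fin K × I × ℝ) :
    roundKernel A π ν t h =
      ∑ j, A.policy t (observed h) {j} • (armLaw π ν t j).map (Prod.mk j) := by
  ext s hs
  rw [← lintegral_indicator_one hs,
    lintegral_roundKernel A π ν t h (measurable_one.indicator hs)]
  simp only [Measure.coe_finsetSum, Finset.sum_apply, Measure.smul_apply, smul_eq_mul]
  refine Finset.sum_congr rfl fun j _ => ?_
  rw [Measure.map_apply measurable_prodMk_left hs,
    ← lintegral_indicator_one (measurable_prodMk_left hs)]
  rfl

/-- The one-step recursion behind the supermartingale argument. Nonnegative integrals spare any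
integrability check. -/
lemma lintegral_cabLaw_succ (t : ℕ) {F : (Fin (t + 1) → Fin K × I × ℝ) → ENNReal}
    (hF : Measurable F) :
    ∫⁻ h, F h ∂(cabLaw A π ν (t + 1)) =
      ∫⁻ h, ∑ j, A.policy t (observed h) {j} *
        ∫⁻ w, F (Fin.snoc h (j, w)) ∂(armLaw π ν t j) ∂(cabLaw A π ν t) := by
  rw [cabLaw, lintegral_map hF measurable_snoc_pair,
    Measure.lintegral_compProd (f := fun p => F (Fin.snoc p.1 p.2))
      (hF.comp measurable_snoc_pair)]
  refine lintegral_congr fun h => ?_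
  rw [lintegral_roundKernel]
  exact hF.comp (measurable_snoc_pair.comp measurable_prodMk_left)

lemma sum_policy (t : ℕ) (h : Fin t → Fin K × I × ℝ) :
    ∑ j, A.policy t (observed h) {j} = 1 := by
  have := A.markov t
  simp

lemma ofReal_integral_le_lintegral {α : Type*} [MeasurableSpace α] {μ : Measure α} {f : α → ℝ}
    (hf : Integrable f μ) : ENNReal.ofReal (∫ a, f a ∂μ) ≤ ∫⁻ a, ENNReal.ofReal (f a) ∂μ := by
  refine ENNReal.ofReal_le_of_le_toReal ?_
  rw [integral_eq_lintegral_pos_part_sub_lintegral_neg_part hf]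
  exact sub_le_self _ ENNReal.toReal_nonneg

lemma _root_.MeasureTheory.Integrable.comp_fst_compProd {α β : Type*} [MeasurableSpace α]
    [MeasurableSpace β] {μ : Measure α} [SFinite μ] {f : α → ℝ} (hf : Integrable f μ)
    (κ : Kernel α β) [IsMarkovKernel κ] : Integrable (fun p => f p.1) (μ ⊗ₘ κ) :=
  (MeasurePreserving.mk measurable_fst (Measure.fst_compProd μ κ)).integrable_comp_of_integrable hf

variable {A π ν} {m : Fin K → ℝ}

lemma integral_reward_roundKernel (hint : ∀ t j, Integrable Prod.snd (armLaw π ν t j))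
    (hm : ∀ t j, ∫ w, w.2 ∂(armLaw π ν t j) = m j) (t : ℕ) (h : Fin t → Fin K × I × ℝ) :
    ∫ z, z.2.2 ∂(roundKernel A π ν t h) =
      ∑ j, (A.policy t (observed h) {j}).toReal * m j := by
  have := A.markov t
  have hmeas : Measurable fun z : Fin K × I × ℝ => z.2.2 := by fun_prop
  rw [roundKernel_eq_sum, integral_finsetSum_measure]
  · refine Finset.sum_congr rfl fun j _ => ?_
    rw [integral_smul_measure, integral_map measurable_prodMk_left.aemeasurable
      hmeas.aestronglyMeasurable, hm, smul_eq_mul]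
  · intro j _
    refine Integrable.smul_measure ?_ (measure_ne_top _ _)
    rw [integrable_map_measure hmeas.aestronglyMeasurable measurable_prodMk_left.aemeasurable]
    exact hint t j

lemma integrable_reward_compProd
    {C : ENNReal} (hC : C ≠ ⊤) (hbound : ∀ t j, ∫⁻ w, ‖w.2‖ₑ ∂(armLaw π ν t j) ≤ C) (t : ℕ) :
    Integrable (fun p : (Fin t → Fin K × I × ℝ) × Fin K × I × ℝ => p.2.2.2)
      (cabLaw A π ν t ⊗ₘ roundKernel A π ν t) := by
  have hmeas : Measurable (fun p : (Fin t → Fin K × I × ℝ) × Fin K × I × ℝ => p.2.2.2) := by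
    fun_prop
  refine ⟨hmeas.aestronglyMeasurable, ?_⟩
  rw [HasFiniteIntegral, Measure.lintegral_compProd hmeas.enorm]
  refine lt_of_le_of_lt (lintegral_mono (g := fun _ => C) fun h => ?_) (by simpa using hC.lt_top)
  dsimp only
  rw [lintegral_roundKernel A π ν t h (F := fun z => ‖z.2.2‖ₑ) (by fun_prop)]
  calc _ ≤ ∑ j, A.policy t (observed h) {j} * C :=
        Finset.sum_le_sum fun j _ => by gcongr; exact hbound t j
    _ = C := by rw [← Finset.sum_mul, sum_policy, one_mul]

lemma integrable_sum_reward
    {C : ENNReal} (hC : C ≠ ⊤) (hbound : ∀ t j, ∫⁻ w, ‖w.2‖ₑ ∂(armLaw π ν t j) ≤ C) (t : ℕ) :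
    Integrable (fun h => ∑ s, (h s).2.2) (cabLaw A π ν t) := by
  induction t with
  | zero => simp
  | succ t ih =>
    have hmeas : Measurable fun h : Fin (t + 1) → Fin K × I × ℝ => ∑ s, (h s).2.2 := by fun_prop
    rw [cabLaw, integrable_map_measure hmeas.aestronglyMeasurable measurable_snoc_pair.aemeasurable]
    have : (fun h : Fin (t + 1) → Fin K × I × ℝ => ∑ s, (h s).2.2) ∘
        (fun p : (Fin t → Fin K × I × ℝ) × Fin K × I × ℝ => Fin.snoc p.1 p.2) =
        fun p => (∑ s, (p.1 s).2.2) + p.2.2.2 := by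
      funext p
      simp [Fin.sum_univ_castSucc]
    rw [this]
    exact (ih.comp_fst_compProd (roundKernel A π ν t)).add (integrable_reward_compProd hC hbound t)

/-- The regret with respect to a benchmark `b` decomposes into the gaps of the arms played. -/
lemma ofReal_regret_le
    {C : ENNReal} (hC : C ≠ ⊤) (hbound : ∀ t j, ∫⁻ w, ‖w.2‖ₑ ∂(armLaw π ν t j) ≤ C)
    (hm : ∀ t j, ∫ w, w.2 ∂(armLaw π ν t j) = m j) (b : ℝ) (t : ℕ) :
    ENNReal.ofReal (t * b - ∫ h, ∑ s, (h s).2.2 ∂(cabLaw A π ν t)) ≤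
      ∑ r ∈ Finset.range t, ∫⁻ h, ∑ j, A.policy r (observed h) {j} * ENNReal.ofReal (b - m j)
        ∂(cabLaw A π ν r) := by
  have hint : ∀ t j, Integrable Prod.snd (armLaw π ν t j) := fun t j =>
    ⟨measurable_snd.aestronglyMeasurable, (hbound t j).trans_lt hC.lt_top⟩
  induction t with
  | zero => simp
  | succ t ih =>
    have hmeas : Measurable fun h : Fin (t + 1) → Fin K × I × ℝ => ∑ s, (h s).2.2 := by fun_prop
    have hlast := integrable_reward_compProd (A := A) hC hbound t
    have hfst := (integrable_sum_reward (A := A) hC hbound t).comp_fst_compProd (roundKernel A π ν t)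
    have hstep : ∫ h, ∑ s, (h s).2.2 ∂(cabLaw A π ν (t + 1)) =
        ∫ h, ∑ s, (h s).2.2 ∂(cabLaw A π ν t) +
          ∫ h, ∫ z, z.2.2 ∂(roundKernel A π ν t h) ∂(cabLaw A π ν t) := by
      rw [cabLaw, integral_map measurable_snoc_pair.aemeasurable hmeas.aestronglyMeasurable]
      simp only [Fin.sum_univ_castSucc, Fin.snoc_castSucc, Fin.snoc_last]
      rw [integral_add hfst hlast, Measure.integral_compProd hlast, Measure.integral_compProd hfst]
      simp
    have hgap : Integrable (fun h => ∫ z, z.2.2 ∂(roundKernel A π ν t h)) (cabLaw A π ν t) :=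
      Integrable.integral_compProd hlast
    rw [Finset.sum_range_succ, hstep]
    have heq : ((t + 1 : ℕ) : ℝ) * b - (∫ h, ∑ s, (h s).2.2 ∂(cabLaw A π ν t) +
          ∫ h, ∫ z, z.2.2 ∂(roundKernel A π ν t h) ∂(cabLaw A π ν t)) =
        (t * b - ∫ h, ∑ s, (h s).2.2 ∂(cabLaw A π ν t)) +
          ∫ h, (b - ∫ z, z.2.2 ∂(roundKernel A π ν t h)) ∂(cabLaw A π ν t) := by
      rw [integral_sub (integrable_const b) hgap]
      simp only [integral_const, probReal_univ, one_smul]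
      push_cast
      ring
    rw [heq]
    refine ENNReal.ofReal_add_le.trans (add_le_add ih ?_)
    refine (ofReal_integral_le_lintegral ((integrable_const b).sub hgap)).trans
      (lintegral_mono fun h => ?_)
    dsimp only
    have hP := A.markov t
    have hsum : ∑ j, (A.policy t (observed h) {j}).toReal = 1 := by
      rw [← ENNReal.toReal_sum fun j _ => measure_ne_top _ _, sum_policy, ENNReal.toReal_one]
    have : b - ∫ z, z.2.2 ∂(roundKernel A π ν t h) =
        ∑ j, (A.policy t (observed h) {j}).toReal * (b - m j) := by
      rw [integral_reward_roundKernel hint hm]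
      simp only [mul_sub, Finset.sum_sub_distrib, ← Finset.sum_mul, hsum, one_mul]
    rw [Pi.sub_apply, this]
    -- The benchmark may lie below some means, so negative gaps are truncated at 0.
    calc ENNReal.ofReal (∑ j, (A.policy t (observed h) {j}).toReal * (b - m j))
        ≤ ENNReal.ofReal (∑ j, (A.policy t (observed h) {j}).toReal * max (b - m j) 0) := by
          gcongr; exact le_max_left _ _
      _ = ∑ j, A.policy t (observed h) {j} * ENNReal.ofReal (b - m j) := by
          rw [ENNReal.ofReal_sum_of_nonneg fun j _ => by positivity]
          refine Finset.sum_congr rfl fun j _ => ?_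
          rw [ENNReal.ofReal_mul ENNReal.toReal_nonneg, ENNReal.ofReal_toReal (measure_ne_top _ _)]
          simp [ENNReal.ofReal_max]

end CabLaw

/-! ### Play counts, centered reward sums and exponential weights -/

section Deviation

variable {K t : ℕ}

/-- The sum of the rewards of arm `i`, centered at `m`. -/
noncomputable def deviation (m : ℝ) (h : Fin t → Fin K × ℝ) (i : Fin K) : ℝ :=
  ∑ s, if (h s).1 = i then (h s).2 - m else 0

lemma pulls_eq_sum (h : Fin t → Fin K × ℝ) (i : Fin K) :
    pulls h i = ∑ s, if (h s).1 = i then 1 else 0 := by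
  simp [pulls]

lemma deviation_eq (m : ℝ) (h : Fin t → Fin K × ℝ) (i : Fin K) (hi : pulls h i ≠ 0) :
    deviation m h i = pulls h i * (empMean h i - m) := by
  have hne : (pulls h i : ℝ) ≠ 0 := by exact_mod_cast hi
  rw [mul_sub, empMean, mul_div_cancel₀ _ hne, deviation, ← Finset.sum_filter,
    Finset.sum_sub_distrib, Finset.sum_const, nsmul_eq_mul, pulls]

lemma pulls_le (h : Fin t → Fin K × ℝ) (i : Fin K) : pulls h i ≤ t := by
  simpa [pulls] using Finset.card_filter_le (Finset.univ : Finset (Fin t)) fun s => (h s).1 = i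

lemma pulls_snoc (h : Fin t → Fin K × ℝ) (z : Fin K × ℝ) (i : Fin K) :
    pulls (Fin.snoc h z : Fin (t + 1) → Fin K × ℝ) i = pulls h i + if z.1 = i then 1 else 0 := by
  simp only [pulls_eq_sum, Fin.sum_univ_castSucc, Fin.snoc_castSucc, Fin.snoc_last]

lemma deviation_snoc (m : ℝ) (h : Fin t → Fin K × ℝ) (z : Fin K × ℝ) (i : Fin K) :
    deviation m (Fin.snoc h z : Fin (t + 1) → Fin K × ℝ) i =
      deviation m h i + if z.1 = i then z.2 - m else 0 := by
  simp [deviation, Fin.sum_univ_castSucc]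

lemma measurableSet_arm_eq (s : Fin t) (i : Fin K) :
    MeasurableSet {h : Fin t → Fin K × ℝ | (h s).1 = i} :=
  measurableSet_eq_fun (f := fun h : Fin t → Fin K × ℝ => (h s).1) (by fun_prop) measurable_const

@[fun_prop]
lemma measurable_pulls (i : Fin K) : Measurable fun h : Fin t → Fin K × ℝ => pulls h i := by
  simp only [pulls_eq_sum]
  exact Finset.measurable_sum _ fun s _ =>
    Measurable.ite (measurableSet_arm_eq s i) measurable_const measurable_const

@[fun_prop]
lemma measurable_deviation (m : ℝ) (i : Fin K) :
    Measurable fun h : Fin t → Fin K × ℝ => deviation m h i := by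
  unfold deviation
  exact Finset.measurable_sum _ fun s _ =>
    Measurable.ite (measurableSet_arm_eq s i) (by fun_prop) measurable_const

/-- The exponential supermartingale associated with the rewards of arm `i`. -/
noncomputable def expWeight (l v m : ℝ) (i : Fin K) (h : Fin t → Fin K × ℝ) : ENNReal :=
  ENNReal.ofReal (Real.exp (l * deviation m h i - l ^ 2 * v / 2 * pulls h i))

@[fun_prop]
lemma measurable_expWeight (l v m : ℝ) (i : Fin K) :
    Measurable fun h : Fin t → Fin K × ℝ => expWeight l v m i h := by
  unfold expWeight
  have : Measurable fun h : Fin t → Fin K × ℝ => (pulls h i : ℝ) :=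
    measurable_from_top.comp (measurable_pulls i)
  fun_prop

lemma expWeight_snoc_ne (l v m : ℝ) {i j : Fin K} (hij : j ≠ i) (h : Fin t → Fin K × ℝ) (y : ℝ) :
    expWeight l v m i (Fin.snoc h (j, y) : Fin (t + 1) → Fin K × ℝ) = expWeight l v m i h := by
  simp [expWeight, pulls_snoc, deviation_snoc, hij]

lemma expWeight_snoc_self (l v m : ℝ) (i : Fin K) (h : Fin t → Fin K × ℝ) (y : ℝ) :
    expWeight l v m i (Fin.snoc h (i, y) : Fin (t + 1) → Fin K × ℝ) =
      expWeight l v m i h * ENNReal.ofReal (Real.exp (-(l ^ 2 * v / 2))) *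
        ENNReal.ofReal (Real.exp (l * (y - m))) := by
  simp only [expWeight, pulls_snoc, deviation_snoc, if_true]
  rw [← ENNReal.ofReal_mul (Real.exp_pos _).le, ← ENNReal.ofReal_mul (by positivity),
    ← Real.exp_add, ← Real.exp_add]
  congr 2
  push_cast
  ring

end Deviation

/-! ### Exponential moments at a fixed time and at a fixed number of plays -/

section Supermartingale

variable {K : ℕ} {A : FiniteAlgorithm K} {π : Fin K → Measure I} {ν : ℕ → Kernel I ℝ}
  [hπ : ∀ i, IsProbabilityMeasure (π i)] [hν : ∀ t, IsMarkovKernel (ν t)]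
  {l v m : ℝ} {i : Fin K}

/-- The expectation of the exponential supermartingale of arm `i`, as long as the arm has been
played at most `s` times, plus its expected value when the arm is played for the `(s + 1)`-st time,
is at most `1`. -/
lemma lintegral_expWeight_add_le
    (hmgf : ∀ t, ∫⁻ w, ENNReal.ofReal (Real.exp (l * (w.2 - m))) ∂(armLaw π ν t i) ≤
      ENNReal.ofReal (Real.exp (l ^ 2 * v / 2))) (s t : ℕ) :
    ∫⁻ h, (if pulls (observed h) i ≤ s then expWeight l v m i (observed h) else 0)
        ∂(cabLaw A π ν t) +
      ∑ r ∈ Finset.range t, ∫⁻ h, A.policy r (observed h) {i} *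
        (if pulls (observed h) i = s then expWeight l v m i (observed h) else 0)
          ∂(cabLaw A π ν r) ≤ 1 := by
  have hW : ∀ r, Measurable fun h : Fin r → Fin K × I × ℝ => expWeight l v m i (observed h) :=
    fun r => (measurable_expWeight l v m i).comp measurable_observed
  have hN : ∀ r, Measurable fun h : Fin r → Fin K × I × ℝ => pulls (observed h) i :=
    fun r => (measurable_pulls i).comp measurable_observed
  have hF : ∀ r, Measurable fun h : Fin r → Fin K × I × ℝ =>
      if pulls (observed h) i ≤ s then expWeight l v m i (observed h) else 0 := fun r =>
    Measurable.ite (measurableSet_le (hN r) measurable_const) (hW r) measurable_const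
  have hG : ∀ r, Measurable fun h : Fin r → Fin K × I × ℝ =>
      if pulls (observed h) i = s then expWeight l v m i (observed h) else 0 := fun r =>
    Measurable.ite (measurableSet_eq_fun (hN r) measurable_const) (hW r) measurable_const
  induction t with
  | zero =>
    refine le_trans (add_le_add (lintegral_mono (g := fun _ => 1) fun h => ?_) le_rfl) (by simp)
    dsimp only
    split_ifs
    · simp [expWeight, deviation, pulls]
    · exact zero_le_one
  | succ t ih =>
    refine le_trans ?_ ih
    rw [Finset.sum_range_succ, add_comm (Finset.sum _ _), ← add_assoc]
    refine add_le_add ?_ le_rfl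
    have hpG : Measurable fun h : Fin t → Fin K × I × ℝ => A.policy t (observed h) {i} *
        if pulls (observed h) i = s then expWeight l v m i (observed h) else 0 :=
      (measurable_policy A t i).mul (hG t)
    rw [lintegral_cabLaw_succ A π ν t (hF (t + 1)), ← lintegral_add_right _ hpG]
    refine lintegral_mono fun h => ?_
    dsimp only
    set a := expWeight l v m i (observed h)
    set N := pulls (observed h) i
    -- Another arm leaves the weight unchanged; arm i multiplies it by a factor of mean at most 1,
    -- and the indicator kills it once the count exceeds s.
    have hstep : ∀ j, ∫⁻ w, (if pulls (observed (Fin.snoc h (j, w) :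
          Fin (t + 1) → Fin K × I × ℝ)) i ≤ s
          then expWeight l v m i (observed (Fin.snoc h (j, w) : Fin (t + 1) → Fin K × I × ℝ))
          else 0) ∂(armLaw π ν t j) ≤
        if j = i then (if N + 1 ≤ s then a else 0) else (if N ≤ s then a else 0) := by
      intro j
      simp only [observed_snoc, pulls_snoc]
      by_cases hj : j = i
      · subst hj
        simp only [if_true]
        by_cases hs : N + 1 ≤ s
        · simp only [hs, N, if_true, expWeight_snoc_self]
          rw [lintegral_const_mul _ (by fun_prop)]
          calc _ ≤ a * ENNReal.ofReal (Real.exp (-(l ^ 2 * v / 2))) *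
                ENNReal.ofReal (Real.exp (l ^ 2 * v / 2)) := by gcongr; exact hmgf t
            _ = a := by
              rw [mul_assoc, ← ENNReal.ofReal_mul (Real.exp_pos _).le, ← Real.exp_add]
              simp
        · simp [N, hs]
      · simp only [hj, if_false, add_zero, expWeight_snoc_ne l v m hj]
        simp [N, a]
    calc _ ≤ (∑ j, A.policy t (observed h) {j} *
            if j = i then (if N + 1 ≤ s then a else 0) else (if N ≤ s then a else 0)) +
            A.policy t (observed h) {i} * (if N = s then a else 0) := by
          gcongr with j _
          exact hstep j
      _ = ∑ j, A.policy t (observed h) {j} * (if j = i then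
            (if N + 1 ≤ s then a else 0) + (if N = s then a else 0)
            else (if N ≤ s then a else 0)) := by
          rw [← Finset.add_sum_erase _ _ (Finset.mem_univ i),
            ← Finset.add_sum_erase _ (fun j => A.policy t (observed h) {j} * (if j = i then
            (if N + 1 ≤ s then a else 0) + (if N = s then a else 0)
            else (if N ≤ s then a else 0))) (Finset.mem_univ i)]
          simp only [if_true, mul_add]
          rw [add_right_comm]
          congr 1
          refine Finset.sum_congr rfl fun j hj => ?_
          simp [Finset.ne_of_mem_erase hj]
      -- The weight killed at N = s is what the new summand collects: N + 1 ≤ s and N = s are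
      -- exclusive, and together amount to N ≤ s.
      _ ≤ ∑ j, A.policy t (observed h) {j} * (if N ≤ s then a else 0) := by
          gcongr with j _
          split_ifs <;> first | omega | simp
      _ = if N ≤ s then a else 0 := by rw [← Finset.sum_mul, sum_policy, one_mul]

/-- At any fixed time, the exponential supermartingale has expectation at most `1`. -/
lemma lintegral_expWeight_le
    (hmgf : ∀ t, ∫⁻ w, ENNReal.ofReal (Real.exp (l * (w.2 - m))) ∂(armLaw π ν t i) ≤
      ENNReal.ofReal (Real.exp (l ^ 2 * v / 2))) (t : ℕ) :
    ∫⁻ h, expWeight l v m i (observed h) ∂(cabLaw A π ν t) ≤ 1 := by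
  refine le_trans (le_of_eq ?_)
    (le_self_add.trans (lintegral_expWeight_add_le (A := A) hmgf t t))
  refine lintegral_congr fun h => ?_
  rw [if_pos (pulls_le _ _)]

/-- Exponential moment of the centered rewards of arm `i` when it is played for the `(s + 1)`-st
time. -/
lemma sum_lintegral_exp_deviation_le
    (hmgf : ∀ t, ∫⁻ w, ENNReal.ofReal (Real.exp (l * (w.2 - m))) ∂(armLaw π ν t i) ≤
      ENNReal.ofReal (Real.exp (l ^ 2 * v / 2))) (s t : ℕ) :
    ∑ r ∈ Finset.range t, ∫⁻ h, A.policy r (observed h) {i} *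
        (if pulls (observed h) i = s then
          ENNReal.ofReal (Real.exp (l * deviation m (observed h) i)) else 0)
          ∂(cabLaw A π ν r) ≤ ENNReal.ofReal (Real.exp (l ^ 2 * v / 2 * s)) := by
  have key : ∀ (r : ℕ) (h : Fin r → Fin K × I × ℝ),
      A.policy r (observed h) {i} * (if pulls (observed h) i = s then
          ENNReal.ofReal (Real.exp (l * deviation m (observed h) i)) else 0) =
      ENNReal.ofReal (Real.exp (l ^ 2 * v / 2 * s)) * (A.policy r (observed h) {i} *
        (if pulls (observed h) i = s then expWeight l v m i (observed h) else 0)) := by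
    intro r h
    rw [mul_left_comm]
    congr 1
    split_ifs with hs
    · rw [expWeight, hs, ← ENNReal.ofReal_mul (Real.exp_pos _).le, ← Real.exp_add]
      congr 2
      ring
    · simp
  simp only [key]
  simp only [lintegral_const_mul' _ _ ENNReal.ofReal_ne_top]
  rw [← Finset.mul_sum]
  calc _ ≤ ENNReal.ofReal (Real.exp (l ^ 2 * v / 2 * s)) * 1 := by
        gcongr
        exact le_add_self.trans (lintegral_expWeight_add_le (A := A) hmgf s t)
    _ = _ := mul_one _

end Supermartingale

/-! ### Deterministic estimates on bonuses and exponential sums -/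

section Analysis

/-- The exploration bonus of MOSS after `s` plays of an arm, where `r` is the average number of
plays per arm. -/
noncomputable def bonus (c r : ℝ) (s : ℕ) : ℝ :=
  √(c * max (Real.log (r / s)) 0 / s)

/-- As the right side is positive, it also bounds the positive part of x. This replaces tail
integration. -/
lemma le_exp_mul_sub_one_div {k : ℝ} (hk : 0 < k) (x : ℝ) : x ≤ Real.exp (k * x - 1) / k := by
  rw [le_div_iff₀ hk]
  linarith [Real.add_one_le_exp (k * x - 1)]

lemma log_le_sqrt {x : ℝ} (hx : 0 < x) : Real.log x ≤ √x := by
  have h0 : 0 < √(√x) := Real.sqrt_pos.2 (Real.sqrt_pos.2 hx)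
  have h1 : √x = √(√x) ^ 2 := (Real.sq_sqrt (Real.sqrt_nonneg _)).symm
  have h2 : x = √(√x) ^ 4 := by
    rw [show 4 = 2 * 2 from rfl, pow_mul, Real.sq_sqrt (Real.sqrt_nonneg _), Real.sq_sqrt hx.le]
  have h3 : Real.log x = 4 * Real.log √(√x) := by
    conv_lhs => rw [h2]
    rw [Real.log_pow]
    norm_num
  nlinarith [Real.log_le_sub_one_of_pos h0, sq_nonneg (√(√x) - 2)]

/-- By log u ≤ √u the bonus is at most r^(1/4) s^(-3/4), hence at most the increment of 4 r^(1/4)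
s^(1/4). The truncation at r reflects that the bonus vanishes beyond r, and makes the telescoped sum
independent of the horizon. -/
lemma bonus_succ_le {c r : ℝ} (hc : c ≤ 1) (hr : 0 < r) (n : ℕ) :
    bonus c r (n + 1) ≤
      4 * √(√r) * √(√(min ((n + 1 : ℕ) : ℝ) r)) - 4 * √(√r) * √(√(min (n : ℝ) r)) := by
  by_cases h : ((n + 1 : ℕ) : ℝ) ≤ r
  · have h' : (n : ℝ) ≤ r := le_trans (by push_cast; linarith) h
    rw [min_eq_left h, min_eq_left h']
    have hn : (0 : ℝ) < ((n + 1 : ℕ) : ℝ) := by positivity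
    set g := √(√r)
    set q := √(√((n + 1 : ℕ) : ℝ))
    set p := √(√(n : ℝ))
    have hg : 0 < g := Real.sqrt_pos.2 (Real.sqrt_pos.2 hr)
    have hq : 0 < q := Real.sqrt_pos.2 (Real.sqrt_pos.2 hn)
    have hp : 0 ≤ p := Real.sqrt_nonneg _
    have hpq : p ≤ q := Real.sqrt_le_sqrt (Real.sqrt_le_sqrt (by push_cast; linarith))
    have hg2 : g ^ 2 = √r := Real.sq_sqrt (Real.sqrt_nonneg _)
    have hq2 : q ^ 2 = √((n + 1 : ℕ) : ℝ) := Real.sq_sqrt (Real.sqrt_nonneg _)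
    have hp2 : p ^ 2 = √(n : ℝ) := Real.sq_sqrt (Real.sqrt_nonneg _)
    have hq4 : q ^ 4 = n + 1 := by
      rw [show 4 = 2 * 2 from rfl, pow_mul, hq2, Real.sq_sqrt hn.le]; push_cast; ring
    have hp4 : p ^ 4 = n := by
      rw [show 4 = 2 * 2 from rfl, pow_mul, hp2, Real.sq_sqrt (Nat.cast_nonneg n)]
    have hbonus : bonus c r (n + 1) ≤ g / q ^ 3 := by
      rw [bonus]
      refine Real.sqrt_le_iff.2 ⟨by positivity, ?_⟩
      have hlog : max (Real.log (r / ((n + 1 : ℕ) : ℝ))) 0 ≤ g ^ 2 / q ^ 2 := by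
        refine max_le ((log_le_sqrt (by positivity)).trans (le_of_eq ?_)) (by positivity)
        rw [Real.sqrt_div hr.le, hg2, hq2]
      have : c * max (Real.log (r / ((n + 1 : ℕ) : ℝ))) 0 ≤ g ^ 2 / q ^ 2 := by
        nlinarith [le_max_right (Real.log (r / ((n + 1 : ℕ) : ℝ))) 0]
      calc _ ≤ g ^ 2 / q ^ 2 / ((n + 1 : ℕ) : ℝ) := by gcongr
        _ = g ^ 2 / q ^ 2 / q ^ 4 := by rw [hq4]; push_cast; rfl
        _ = (g / q ^ 3) ^ 2 := by field_simp
    refine hbonus.trans ?_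
    rw [div_le_iff₀ (by positivity)]
    have h1 : 1 ≤ 4 * (q - p) * q ^ 3 := by
      have : (q - p) * ((q + p) * (q ^ 2 + p ^ 2)) = 1 := by
        have : q ^ 4 - p ^ 4 = 1 := by rw [hq4, hp4]; ring
        linarith
      have h2 : (q + p) * (q ^ 2 + p ^ 2) ≤ 4 * q ^ 3 := by
        have hpp : p ^ 2 ≤ q ^ 2 := by gcongr
        calc _ ≤ (q + q) * (q ^ 2 + q ^ 2) := by gcongr
          _ = _ := by ring
      nlinarith [mul_le_mul_of_nonneg_left h2 (sub_nonneg.2 hpq)]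
    calc g = g * 1 := (mul_one g).symm
      _ ≤ g * (4 * (q - p) * q ^ 3) := by gcongr
      _ = _ := by ring
  · have hlog : Real.log (r / ((n + 1 : ℕ) : ℝ)) ≤ 0 :=
      Real.log_nonpos (by positivity) ((div_le_one (by positivity)).2 (not_le.1 h).le)
    have : bonus c r (n + 1) = 0 := by rw [bonus, max_eq_right hlog]; simp
    rw [this, sub_nonneg]
    gcongr
    exact Nat.le_succ n

lemma sum_bonus_le {c r : ℝ} (hc : c ≤ 1) (hr : 0 < r) (n : ℕ) :
    ∑ s ∈ Finset.range n, bonus c r s ≤ 4 * √r := by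
  have key : ∀ n : ℕ, ∑ s ∈ Finset.range (n + 1), bonus c r s ≤
      4 * √(√r) * √(√(min (n : ℝ) r)) := by
    intro n
    induction n with
    | zero => simp [bonus, hr.le]
    | succ n ih =>
      rw [Finset.sum_range_succ]
      linarith [bonus_succ_le hc hr n]
  calc _ ≤ ∑ s ∈ Finset.range (n + 1), bonus c r s := by
        rw [Finset.sum_range_succ]
        exact le_add_of_nonneg_right (Real.sqrt_nonneg _)
    _ ≤ 4 * √(√r) * √(√(min (n : ℝ) r)) := key n
    _ ≤ 4 * √(√r) * √(√r) := by gcongr; exact min_le_right _ _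
    _ = 4 * √r := by rw [mul_assoc, Real.mul_self_sqrt (Real.sqrt_nonneg _)]

/-- A lower Riemann sum of ∫ exp(-g u) du = 1/g at the nodes u = √(2s), because 1/√(2s) is at most
the last node spacing. The term s = 0 is 0 by the convention on division. -/
lemma sum_exp_neg_sqrt_div_le {g : ℝ} (hg : 0 < g) (n : ℕ) :
    ∑ s ∈ Finset.range n, Real.exp (-(√(2 * s) * g)) / √(2 * s) ≤ 1 / g := by
  have key : ∀ n : ℕ, ∑ s ∈ Finset.range (n + 1), Real.exp (-(√(2 * s) * g)) / √(2 * s) ≤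
      1 / g * (1 - Real.exp (-(√(2 * n) * g))) := by
    intro n
    induction n with
    | zero => simp
    | succ n ih =>
      rw [Finset.sum_range_succ]
      set q := √(2 * ((n + 1 : ℕ) : ℝ))
      set p := √(2 * (n : ℝ))
      have hq : 0 < q := Real.sqrt_pos.2 (by positivity)
      have hp : 0 ≤ p := Real.sqrt_nonneg _
      have hpq : p ≤ q := Real.sqrt_le_sqrt (by push_cast; linarith)
      have hq2 : q ^ 2 = 2 * n + 2 := by rw [Real.sq_sqrt (by positivity)]; push_cast; ring
      have hp2 : p ^ 2 = 2 * n := Real.sq_sqrt (by positivity)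
      have hstep : 1 / q ≤ q - p := by
        rw [div_le_iff₀ hq]
        nlinarith
      have hexp : Real.exp (-(q * g)) * (1 + (q - p) * g) ≤ Real.exp (-(p * g)) := by
        have : Real.exp (-(p * g)) = Real.exp (-(q * g)) * Real.exp ((q - p) * g) := by
          rw [← Real.exp_add]; congr 1; ring
        rw [this]
        gcongr
        linarith [Real.add_one_le_exp ((q - p) * g)]
      have : Real.exp (-(q * g)) / q ≤
          1 / g * (Real.exp (-(p * g)) - Real.exp (-(q * g))) := by
        calc Real.exp (-(q * g)) / q = Real.exp (-(q * g)) * (1 / q) := by ring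
          _ ≤ Real.exp (-(q * g)) * (q - p) := by gcongr
          _ = 1 / g * (Real.exp (-(q * g)) * (1 + (q - p) * g) - Real.exp (-(q * g))) := by
            field_simp; ring
          _ ≤ _ := by gcongr
      linarith
  calc _ ≤ ∑ s ∈ Finset.range (n + 1), Real.exp (-(√(2 * s) * g)) / √(2 * s) := by
        rw [Finset.sum_range_succ]
        exact le_add_of_nonneg_right (by positivity)
    _ ≤ _ := key n
    _ ≤ 1 / g * 1 := by gcongr; linarith [Real.exp_pos (-(√(2 * (n : ℝ)) * g))]
    _ = 1 / g := mul_one _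

/-- The rate of decay, over the geometric blocks of numbers of plays, of the probability that the
index of an arm underestimates its mean. -/
lemma sum_two_pow_mul_exp_le (n : ℕ) :
    ∑ j ∈ Finset.range n, 2 ^ j * Real.exp (-(3 / 4 * (j * Real.log 4))) ≤ 7 / 2 := by
  set q := 2 * Real.exp (-(3 / 4 * Real.log 4)) with hq
  have hq0 : 0 ≤ q := by positivity
  have hq2 : q ^ 2 = 1 / 2 := by
    have h4 : Real.log 4 = 2 * Real.log 2 := by
      rw [show (4 : ℝ) = 2 ^ 2 by norm_num, Real.log_pow]; norm_num
    rw [hq, mul_pow, ← Real.exp_nat_mul, h4,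
      show ((2 : ℕ) : ℝ) * -(3 / 4 * (2 * Real.log 2)) = -(((3 : ℕ) : ℝ) * Real.log 2) by
        push_cast; ring, Real.exp_neg, Real.exp_nat_mul, Real.exp_log two_pos]
    norm_num
  -- The ratio is 1/√2; the rational bound 5/7 gives 1/(1 - 5/7) = 7/2.
  have hq1 : q ≤ 5 / 7 := by nlinarith
  have hterm : ∀ j : ℕ, 2 ^ j * Real.exp (-(3 / 4 * (j * Real.log 4))) = q ^ j := by
    intro j
    rw [hq, mul_pow, ← Real.exp_nat_mul]
    congr 2
    ring
  simp only [hterm]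
  have hgeom := geom_sum_mul_neg q n
  nlinarith [pow_nonneg hq0 n, Finset.sum_nonneg fun j (_ : j ∈ Finset.range n) => pow_nonneg hq0 j]

set_option maxHeartbeats 1000000 in
/-- On the block `r / 4 ^ (j + 1) < N ≤ r / 4 ^ j`, the bonus makes up for the deviations measured
at the scale `√(8 j log 4 · 4 ^ j / r)`. -/
lemma exp_block_le {c r : ℝ} (hc : 1 / 2 ≤ c) (hr : 0 < r) {N j : ℕ} (hN : 0 < N) (hj : 1 ≤ j)
    (h1 : 4 ^ j ≤ r / N) (h2 : r / N < 4 ^ (j + 1)) {l : ℝ}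
    (hl : l = √(8 * (j * Real.log 4) * 4 ^ j / r)) :
    0 < l ∧ Real.exp (l ^ 2 / 8 * N - l * N * bonus c r N - 1) / (l * N) ≤
      1 / (2 * √r) * (2 ^ j * Real.exp (-(3 / 4 * (j * Real.log 4)))) := by
  have hN0 : (0 : ℝ) < N := by exact_mod_cast hN
  have hlog4 : 1.38 ≤ Real.log 4 := by
    have h4 : Real.log 4 = 2 * Real.log 2 := by
      rw [show (4 : ℝ) = 2 ^ 2 by norm_num, Real.log_pow]; norm_num
    linarith [Real.log_two_gt_d9]
  set e := (j : ℝ) * Real.log 4 with he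
  have hj1 : (1 : ℝ) ≤ j := by exact_mod_cast hj
  have he1 : 1.38 ≤ e := by nlinarith
  set n := r / 4 ^ j with hn
  have hn0 : 0 < n := by positivity
  have hl' : l = √(8 * e / n) := by rw [hl, hn]; congr 1; field_simp
  have hl0 : 0 < l := by rw [hl']; exact Real.sqrt_pos.2 (by positivity)
  have hl2 : l ^ 2 = 8 * e / n := by rw [hl', Real.sq_sqrt (by positivity)]
  have hNn : (N : ℝ) ≤ n := by
    rw [hn, le_div_iff₀ (by positivity)]
    rw [le_div_iff₀ hN0] at h1
    linarith
  have hnN : n ≤ 4 * N := by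
    rw [hn, div_le_iff₀ (by positivity)]
    rw [div_lt_iff₀ hN0, pow_succ] at h2
    linarith
  have heL : e ≤ Real.log (r / N) := by
    rw [he, ← Real.log_pow]
    exact Real.log_le_log (by positivity) h1
  -- The only use of c ≥ 1/2.
  have hb : √(e / (2 * N)) ≤ bonus c r N := by
    refine Real.sqrt_le_sqrt ?_
    rw [← div_div]
    gcongr
    have := le_max_left (Real.log (r / N)) 0
    nlinarith
  refine ⟨hl0, ?_⟩
  set q := √(n * N)
  have hq0 : 0 < q := Real.sqrt_pos.2 (by positivity)
  have hq2 : q ^ 2 = n * N := Real.sq_sqrt (by positivity)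
  have hlb : l * √(e / (2 * N)) = 2 * e / q := by
    rw [hl', ← Real.sqrt_mul (by positivity)]
    rw [Real.sqrt_eq_iff_eq_sq (by positivity) (by positivity), div_pow, hq2]
    field_simp
    norm_num
  set y := N / q with hy
  have hy2 : y ^ 2 = N / n := by rw [hy, div_pow, hq2]; field_simp
  have hy1 : y ≤ 1 := by
    rw [hy, div_le_one hq0]; nlinarith
  have hy3 : 1 / 2 ≤ y := by
    rw [hy, le_div_iff₀ hq0]; nlinarith
  -- With y = √(N/n) in [1/2, 1], the exponent is at most e(y² - 2y) - 1, and y² - 2y ≤ -3/4 there.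
  have hexp : l ^ 2 / 8 * N - l * N * bonus c r N - 1 ≤ -(3 / 4 * e) + -1 := by
    have : l * N * √(e / (2 * N)) ≤ l * N * bonus c r N := by gcongr
    have h3 : l * N * √(e / (2 * N)) = 2 * e * y := by
      rw [mul_right_comm, hlb, hy]; ring
    have h4 : l ^ 2 / 8 * N = e * y ^ 2 := by rw [hl2, hy2]; ring
    nlinarith [mul_nonneg (by linarith : 0 ≤ e) (mul_nonneg (sub_nonneg.2 hy3)
      (by linarith : 0 ≤ 3 / 2 - y))]
  -- Here j ≥ 1 matters, through e ≥ 1.38: (lN)² = 8eN²/n ≥ 2eN ≥ 0.69 n, as n ≤ 4N.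
  have hlN : 0.83 * √n ≤ l * N := by
    have h5 : √(0.69 * n) ≤ l * N := by
      refine Real.sqrt_le_iff.2 ⟨by positivity, ?_⟩
      rw [mul_pow, hl2]
      have : 8 * e / n * (N : ℝ) ^ 2 = 8 * e * N * (N / n) := by ring
      have h6 : 1 / 4 ≤ N / n := by rw [le_div_iff₀ hn0]; linarith
      rw [this]
      calc 0.69 * n ≤ 0.69 * (4 * N) := by gcongr
        _ ≤ 8 * e * N * (1 / 4) := by nlinarith
        _ ≤ _ := by gcongr
    refine le_trans ?_ h5
    rw [Real.sqrt_mul (by norm_num)]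
    gcongr
    exact Real.le_sqrt_of_sq_le (by norm_num)
  have hsn : √n = √r / 2 ^ j := by
    rw [hn, Real.sqrt_div hr.le,
      show (4 : ℝ) ^ j = (2 ^ j) ^ 2 by rw [← pow_mul, mul_comm, pow_mul]; norm_num,
      Real.sqrt_sq (by positivity)]
  have he' : Real.exp (-1) ≤ 0.4 := by
    have := Real.exp_neg_one_lt_d9
    linarith
  calc _ ≤ Real.exp (-(3 / 4 * e) + -1) / (0.83 * √n) := by gcongr
    _ = Real.exp (-(3 / 4 * e)) * (Real.exp (-1) / (0.83 * √n)) := by rw [Real.exp_add]; ring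
    _ ≤ Real.exp (-(3 / 4 * e)) * (1 / (2 * √n)) := by
      refine mul_le_mul_of_nonneg_left ?_ (Real.exp_pos _).le
      rw [div_le_div_iff₀ (by positivity) (by positivity)]
      nlinarith [Real.sqrt_pos.2 hn0]
    _ = _ := by rw [hsn]; field_simp

end Analysis

/-! ### Regret analysis of MOSS against a benchmark -/

section Moss

variable {K : ℕ} {A : FiniteAlgorithm K} {π : Fin K → Measure I} {ν : ℕ → Kernel I ℝ}
  [hπ : ∀ i, IsProbabilityMeasure (π i)] [hν : ∀ t, IsMarkovKernel (ν t)]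

/-- A bound on the conditional regret suffered when arm `i` is played for the `(s + 1)`-st time,
apart from the terms that do not depend on the arm. -/
noncomputable def playCost (c r g m : ℝ) {t : ℕ} (h : Fin t → Fin K × ℝ) (i : Fin K) (s : ℕ) :
    ENNReal :=
  if pulls h i = s then
    ENNReal.ofReal ((if s = 0 then 1 else 0) + bonus c r s) +
      ENNReal.ofReal (Real.exp (-(√(2 * s) * g) - 1) / √(2 * s)) *
        ENNReal.ofReal (Real.exp (√(2 / s) * deviation m h i))
  else 0

/-- The (s + 1)-st play of an arm occurs at most once, so summing over rounds amounts to evaluating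
the cost at that play. -/
lemma sum_lintegral_playCost_le {m : ℝ} {i : Fin K}
    (hmgf : ∀ t, ∀ l : ℝ, 0 ≤ l → ∫⁻ w, ENNReal.ofReal (Real.exp (l * (w.2 - m)))
      ∂(armLaw π ν t i) ≤ ENNReal.ofReal (Real.exp (l ^ 2 * (1 / 2) / 2))) (c r g : ℝ) (s t : ℕ) :
    ∑ q ∈ Finset.range t, ∫⁻ h, A.policy q (observed h) {i} * playCost c r g m (observed h) i s
        ∂(cabLaw A π ν q) ≤
      ENNReal.ofReal ((if s = 0 then 1 else 0) + bonus c r s +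
        Real.exp (-(√(2 * s) * g)) / √(2 * s)) := by
  set C1 := (if s = 0 then 1 else 0) + bonus c r s with hC1
  set C2 := Real.exp (-(√(2 * s) * g) - 1) / √(2 * s) with hC2
  have hC1' : 0 ≤ C1 := by
    have : 0 ≤ bonus c r s := Real.sqrt_nonneg _
    rw [hC1]; split_ifs <;> linarith
  have hC2' : 0 ≤ C2 := by positivity
  have hcount : ∑ q ∈ Finset.range t, ∫⁻ h, A.policy q (observed h) {i} *
      (if pulls (observed h) i = s then 1 else 0) ∂(cabLaw A π ν q) ≤ 1 := by
    -- At l = 0 the exponential moment is the expected number of (s + 1)-st plays.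
    simpa using sum_lintegral_exp_deviation_le (A := A) (fun t => hmgf t 0 le_rfl) s t
  have hexp := sum_lintegral_exp_deviation_le (A := A)
    (fun t => hmgf t √(2 / s) (Real.sqrt_nonneg _)) s t
  have hsplit : ∀ (q : ℕ) (h : Fin q → Fin K × I × ℝ),
      A.policy q (observed h) {i} * playCost c r g m (observed h) i s =
      ENNReal.ofReal C1 * (A.policy q (observed h) {i} *
        (if pulls (observed h) i = s then 1 else 0)) +
      ENNReal.ofReal C2 * (A.policy q (observed h) {i} * (if pulls (observed h) i = s then
          ENNReal.ofReal (Real.exp (√(2 / s) * deviation m (observed h) i)) else 0)) := by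
    intro q h
    rw [playCost, ← hC1, ← hC2]
    by_cases hp : pulls (observed h) i = s
    · simp only [if_pos hp]
      ring
    · simp [hp]
  have hmeas : ∀ q, Measurable fun h : Fin q → Fin K × I × ℝ => A.policy q (observed h) {i} *
      (if pulls (observed h) i = s then 1 else 0 : ENNReal) := fun q =>
    (measurable_policy A q i).mul (Measurable.ite
      (measurableSet_eq_fun ((measurable_pulls i).comp measurable_observed) measurable_const)
      measurable_const measurable_const)
  simp only [hsplit]
  simp only [fun q => lintegral_add_left ((hmeas q).const_mul (ENNReal.ofReal C1)),
    lintegral_const_mul' _ _ ENNReal.ofReal_ne_top]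
  rw [Finset.sum_add_distrib, ← Finset.mul_sum, ← Finset.mul_sum, ENNReal.ofReal_add hC1'
    (by positivity)]
  refine add_le_add ((mul_le_mul_right hcount _).trans_eq (mul_one _))
    ((mul_le_mul_right hexp _).trans ?_)
  rw [← ENNReal.ofReal_mul hC2', hC2, div_mul_eq_mul_div, ← Real.exp_add]
  refine ENNReal.ofReal_le_ofReal ?_
  gcongr
  rw [Real.sq_sqrt (by positivity)]
  -- For s ≥ 1 the scale √(2/s) yields an exponent 1/2, absorbed by the -1 in `playCost`; for s = 0
  -- both sides vanish.
  rcases Nat.eq_zero_or_pos s with hs | hs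
  · simp [hs]
  · have : (0 : ℝ) < s := by exact_mod_cast hs
    have h1 : 2 / (s : ℝ) * (1 / 2) / 2 * s = 1 / 2 := by field_simp
    rw [h1]
    linarith

/-- The overestimation of an arm is controlled by `playCost`. -/
lemma ofReal_overestimation_le {t : ℕ} (h : Fin t → Fin K × ℝ) (i : Fin K) (c r g m : ℝ)
    (hi : pulls h i ≠ 0) :
    ENNReal.ofReal (bonus c r (pulls h i) + (empMean h i - m - g)) ≤
      playCost c r g m h i (pulls h i) := by
  set s := pulls h i with hs
  have hs0 : (0 : ℝ) < s := by exact_mod_cast Nat.pos_of_ne_zero hi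
  rw [playCost, if_pos hs.symm, if_neg hi, zero_add]
  refine ENNReal.ofReal_add_le.trans (add_le_add le_rfl ?_)
  rw [← ENNReal.ofReal_mul (by positivity)]
  refine ENNReal.ofReal_le_ofReal ?_
  have hk : 0 < √(2 * s) := Real.sqrt_pos.2 (by positivity)
  refine (le_exp_mul_sub_one_div hk _).trans (le_of_eq ?_)
  rw [div_mul_eq_mul_div, ← Real.exp_add, deviation_eq m h i hi, ← hs]
  congr 2
  have : √(2 / s) * s = √(2 * s) := by
    rw [Real.sqrt_div zero_le_two, Real.sqrt_mul zero_le_two, div_mul_eq_mul_div, mul_div_assoc,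
      Real.div_sqrt]
  rw [← mul_assoc, this]
  ring

/-- At a fixed time, the index of an arm does not underestimate its mean by much. -/
lemma lintegral_underestimation_le {m : ℝ} {i : Fin K}
    (hmgf : ∀ t, ∀ l : ℝ, l ≤ 0 → ∫⁻ w, ENNReal.ofReal (Real.exp (l * (w.2 - m)))
      ∂(armLaw π ν t i) ≤ ENNReal.ofReal (Real.exp (l ^ 2 * (1 / 4) / 2)))
    {c r : ℝ} (hc : 1 / 2 ≤ c) (hr : 0 < r) (t : ℕ) :
    ∫⁻ h, (if pulls (observed h) i = 0 then 0 else
        ENNReal.ofReal (m - (empMean (observed h) i + bonus c r (pulls (observed h) i)) - 1 / √r))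
        ∂(cabLaw A π ν t) ≤ ENNReal.ofReal (2 / √r) := by
  -- Finitely many blocks are enough: N ≥ 1 forces r/N ≤ r < 4^J.
  obtain ⟨J, hJ⟩ := pow_unbounded_of_one_lt r (by norm_num : (1 : ℝ) < 4)
  have hsr : 0 < √r := Real.sqrt_pos.2 hr
  have hsr2 : √r ^ 2 = r := Real.sq_sqrt hr.le
  set l : ℕ → ℝ := fun j => √(8 * (j * Real.log 4) * 4 ^ j / r) with hl
  set C : ℕ → ℝ := fun j => 1 / (2 * √r) * (2 ^ j * Real.exp (-(3 / 4 * (j * Real.log 4)))) with hC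
  have hC0 : ∀ j, 0 ≤ C j := fun j => by positivity
  have hpoint : ∀ h : Fin t → Fin K × ℝ, (if pulls h i = 0 then 0 else
        ENNReal.ofReal (m - (empMean h i + bonus c r (pulls h i)) - 1 / √r)) ≤
      ENNReal.ofReal (1 / (5 * √r)) * expWeight (-(8 / √r)) (1 / 4) m i h +
        ∑ j ∈ Finset.range J, ENNReal.ofReal (C j) * expWeight (-(l j)) (1 / 4) m i h := by
    intro h
    by_cases hi : pulls h i = 0
    · simp [hi]
    rw [if_neg hi]
    set N := pulls h i with hN
    have hN1 : (1 : ℝ) ≤ N := by exact_mod_cast Nat.one_le_iff_ne_zero.2 hi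
    have hN0 : (0 : ℝ) < N := by linarith
    have hb : 0 ≤ bonus c r N := Real.sqrt_nonneg _
    -- the exponential bound at an arbitrary scale
    have hgen : ∀ q : ℝ, 0 < q → m - (empMean h i + bonus c r N) - 1 / √r ≤
        Real.exp (q ^ 2 / 8 * N - q * N * (bonus c r N + 1 / √r) - 1) / (q * N) *
          Real.exp (-q * deviation m h i - (-q) ^ 2 * (1 / 4) / 2 * N) := by
      intro q hq
      refine (le_exp_mul_sub_one_div (by positivity : 0 < q * N) _).trans (le_of_eq ?_)
      rw [div_mul_eq_mul_div, ← Real.exp_add, deviation_eq m h i hi, ← hN]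
      congr 2
      ring
    -- In the block N > r/4 the bonus may vanish and the slack 1/√r takes over: the scale q = 8/√r
    -- makes q²N/8 equal to qN/√r.
    by_cases hbig : r / N < 4
    · refine le_trans ?_ le_self_add
      rw [expWeight, ← hN, ← ENNReal.ofReal_mul (by positivity)]
      refine ENNReal.ofReal_le_ofReal ((hgen (8 / √r) (by positivity)).trans
        (mul_le_mul_of_nonneg_right ?_ (Real.exp_pos _).le))
      rw [div_lt_iff₀ hN0] at hbig
      have h1 : (8 / √r) ^ 2 / 8 * N - 8 / √r * N * (bonus c r N + 1 / √r) - 1 ≤ -1 := by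
        have : (8 / √r) ^ 2 / 8 * N = 8 / √r * N * (1 / √r) := by field_simp
        rw [mul_add, this]
        have : 0 ≤ 8 / √r * N * bonus c r N := by positivity
        linarith
      have he : Real.exp (-1) ≤ 0.4 := by
        have := Real.exp_neg_one_lt_d9
        linarith
      calc _ ≤ 0.4 / (8 / √r * N) := by
            gcongr
            exact (Real.exp_le_exp.2 h1).trans he
        _ = 0.4 * √r / (8 * N) := by field_simp
        _ ≤ 1 / (5 * √r) := by
            rw [div_le_div_iff₀ (by positivity) (by positivity)]
            nlinarith
    · obtain ⟨j, hj1, hj2⟩ := exists_nat_pow_near (by linarith : 1 ≤ r / N)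
        (by norm_num : (1 : ℝ) < 4)
      have hj : 1 ≤ j := by
        by_contra hj0
        have : j = 0 := by omega
        subst this
        exact hbig (by simpa using hj2)
      have hjJ : j < J := by
        have : r / N ≤ r := div_le_self hr.le hN1
        exact (pow_lt_pow_iff_right₀ (by norm_num : (1 : ℝ) < 4)).1 (by linarith)
      obtain ⟨hl0, hblock⟩ := exp_block_le hc hr (Nat.pos_of_ne_zero hi) hj hj1 hj2
        (l := l j) rfl
      refine le_trans ?_ (le_add_left (Finset.single_le_sum (f := fun j =>
        ENNReal.ofReal (C j) * expWeight (-(l j)) (1 / 4) m i h) (fun _ _ => zero_le)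
        (Finset.mem_range.2 hjJ)))
      rw [expWeight, ← hN, ← ENNReal.ofReal_mul (hC0 j)]
      refine ENNReal.ofReal_le_ofReal ((hgen (l j) hl0).trans ?_)
      gcongr
      refine le_trans ?_ hblock
      gcongr
      linarith [div_pos one_pos hsr]
  have hW : ∀ q : ℝ, Measurable fun h : Fin t → Fin K × I × ℝ =>
      expWeight (-q) (1 / 4) m i (observed h) := fun q =>
    (measurable_expWeight _ _ _ _).comp measurable_observed
  have hE : ∀ q : ℝ, 0 ≤ q → ∫⁻ h, expWeight (-q) (1 / 4) m i (observed h) ∂(cabLaw A π ν t) ≤ 1 :=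
    fun q hq => lintegral_expWeight_le (fun t => hmgf t (-q) (by linarith)) t
  calc _ ≤ ∫⁻ h, (ENNReal.ofReal (1 / (5 * √r)) * expWeight (-(8 / √r)) (1 / 4) m i (observed h) +
        ∑ j ∈ Finset.range J, ENNReal.ofReal (C j) *
          expWeight (-(l j)) (1 / 4) m i (observed h)) ∂(cabLaw A π ν t) :=
        lintegral_mono fun h => hpoint (observed h)
    _ = ENNReal.ofReal (1 / (5 * √r)) *
          ∫⁻ h, expWeight (-(8 / √r)) (1 / 4) m i (observed h) ∂(cabLaw A π ν t) +
        ∑ j ∈ Finset.range J, ENNReal.ofReal (C j) *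
          ∫⁻ h, expWeight (-(l j)) (1 / 4) m i (observed h) ∂(cabLaw A π ν t) := by
        rw [lintegral_add_left ((hW _).const_mul _), lintegral_const_mul _ (hW _),
          lintegral_finsetSum _ fun j _ => (hW _).const_mul _]
        simp only [lintegral_const_mul _ (hW _)]
    _ ≤ ENNReal.ofReal (1 / (5 * √r)) * 1 + ∑ j ∈ Finset.range J, ENNReal.ofReal (C j) * 1 := by
        gcongr
        · exact hE _ (by positivity)
        · exact hE _ (Real.sqrt_nonneg _)
    _ = ENNReal.ofReal (1 / (5 * √r) + ∑ j ∈ Finset.range J, C j) := by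
        simp only [mul_one]
        rw [ENNReal.ofReal_add (by positivity) (Finset.sum_nonneg fun j _ => hC0 j),
          ENNReal.ofReal_sum_of_nonneg fun j _ => hC0 j]
    _ ≤ ENNReal.ofReal (2 / √r) := by
        refine ENNReal.ofReal_le_ofReal ?_
        rw [hC, ← Finset.mul_sum]
        calc _ ≤ 1 / (5 * √r) + 1 / (2 * √r) * (7 / 2) := by
              gcongr
              exact sum_two_pow_mul_exp_le J
          _ = 1.95 / √r := by field_simp; norm_num
          _ ≤ 2 / √r := by gcongr; norm_num

/-- The regret of MOSS in one round is the cost of the play, plus the underestimation of the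
reference arm, plus a term that is uniformly small. -/
lemma sum_policy_mul_gap_le [NeZero K] {c : ℝ} {T t : ℕ} (hA : IsMOSS c T A) (ht : t < T)
    {b : ℝ} (hb : b ≤ 1) {m : Fin K → ℝ} (hm : ∀ j, 0 ≤ m j) (i : Fin K) (g d : ℝ)
    (h : Fin t → Fin K × ℝ) :
    ∑ j, A.policy t h {j} * ENNReal.ofReal (b - m j) ≤
      ∑ j, A.policy t h {j} *
          ∑ s ∈ Finset.range T, playCost c ((T : ℝ) / K) g (m j) h j s +
        ((if pulls h i = 0 then 0 else ENNReal.ofReal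
          (b - (empMean h i + bonus c ((T : ℝ) / K) (pulls h i)) - d)) +
        ENNReal.ofReal (g + d)) := by
  have hP := A.markov t
  set r := (T : ℝ) / K
  set U := (if pulls h i = 0 then 0 else ENNReal.ofReal
          (b - (empMean h i + bonus c r (pulls h i)) - d))
  have hindex : ∀ j, mossIndex c T h j = if pulls h j = 0 then ⊤ else
      ((empMean h j + bonus c r (pulls h j) : ℝ) : EReal) := by
    intro j
    simp only [mossIndex, bonus, r, div_div]
  have hsum : ∑ j, A.policy t h {j} = 1 := by simp
  have hcost : ∀ j, playCost c r g (m j) h j (pulls h j) ≤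
      ∑ s ∈ Finset.range T, playCost c r g (m j) h j s := fun j =>
    Finset.single_le_sum (f := fun s => playCost c r g (m j) h j s) (fun _ _ => zero_le)
      (Finset.mem_range.2 ((pulls_le h j).trans_lt ht))
  calc _ ≤ ∑ j, A.policy t h {j} * (∑ s ∈ Finset.range T, playCost c r g (m j) h j s +
        (U + ENNReal.ofReal (g + d))) := by
        refine Finset.sum_le_sum fun j _ => ?_
        by_cases hj : ∀ k, mossIndex c T h k ≤ mossIndex c T h j
        · refine mul_le_mul_right (le_trans ?_ (add_le_add (hcost j) le_rfl)) _
          by_cases hj0 : pulls h j = 0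
          · refine le_trans ?_ le_self_add
            rw [playCost, if_pos rfl, if_pos hj0]
            refine le_trans (ENNReal.ofReal_le_ofReal ?_) le_self_add
            have : 0 ≤ bonus c r (pulls h j) := Real.sqrt_nonneg _
            linarith [hm j]
          · have hij := hj i
            -- Arm j has a finite index, so the reference arm, whose index is no larger, has been
            -- played too.
            rw [hindex, hindex, if_neg hj0] at hij
            have hi0 : pulls h i ≠ 0 := by
              intro hi0
              rw [if_pos hi0] at hij
              exact absurd hij (not_le.2 (EReal.coe_lt_top _))
            rw [if_neg hi0, EReal.coe_le_coe_iff] at hij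
            simp only [U, if_neg hi0]
            refine le_trans (ENNReal.ofReal_le_ofReal ?_) (ENNReal.ofReal_add_le.trans
              (add_le_add (ofReal_overestimation_le h j c r g (m j) hj0)
                ENNReal.ofReal_add_le) :
                ENNReal.ofReal ((bonus c r (pulls h j) + (empMean h j - m j - g)) +
                ((b - (empMean h i + bonus c r (pulls h i)) - d) + (g + d))) ≤ _)
            linarith
        · have hzero : A.policy t h {j} = 0 := by
            have hone := hA t ht h
            have hcompl := (prob_compl_eq_zero_iff (μ := A.policy t h)
              (s := {i | ∀ j, mossIndex c T h j ≤ mossIndex c T h i})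
              (Set.toFinite _).measurableSet).2 hone
            exact measure_mono_null (by simpa using hj) hcompl
          simp [hzero]
    _ = _ := by
        simp only [mul_add (A.policy t h _)]
        rw [Finset.sum_add_distrib, Finset.sum_add_distrib, ← Finset.sum_mul, ← Finset.sum_mul,
          hsum, one_mul, one_mul]

/-- Distribution-free regret bound for MOSS, with respect to a benchmark `b` that one of the arms
dominates in the sense of its negative exponential moments. -/
lemma sum_lintegral_gap_moss_le [NeZero K] {c : ℝ} (hc : 1 / 2 ≤ c) (hc' : c ≤ 1) {T : ℕ}
    (hKT : K ≤ T) (hA : IsMOSS c T A) {b : ℝ} (hb : b ≤ 1) {m : Fin K → ℝ} (hm : ∀ j, 0 ≤ m j)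
    (hover : ∀ j, ∀ t, ∀ l : ℝ, 0 ≤ l → ∫⁻ w, ENNReal.ofReal (Real.exp (l * (w.2 - m j)))
      ∂(armLaw π ν t j) ≤ ENNReal.ofReal (Real.exp (l ^ 2 * (1 / 2) / 2)))
    (i : Fin K)
    (hunder : ∀ t, ∀ l : ℝ, l ≤ 0 → ∫⁻ w, ENNReal.ofReal (Real.exp (l * (w.2 - b)))
      ∂(armLaw π ν t i) ≤ ENNReal.ofReal (Real.exp (l ^ 2 * (1 / 4) / 2))) :
    ∑ t ∈ Finset.range T, ∫⁻ h, ∑ j, A.policy t (observed h) {j} * ENNReal.ofReal (b - m j)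
        ∂(cabLaw A π ν t) ≤ ENNReal.ofReal (10 * √(K * T)) := by
  have hK0 : (0 : ℝ) < K := by exact_mod_cast Nat.pos_of_ne_zero (NeZero.ne K)
  have hKT' : (K : ℝ) ≤ T := by exact_mod_cast hKT
  have hT0 : (0 : ℝ) < T := hK0.trans_le hKT'
  set r := (T : ℝ) / K with hr
  have hr0 : 0 < r := by positivity
  have hsr : 0 < √r := Real.sqrt_pos.2 hr0
  set g := 1 / √r with hg
  have hg0 : 0 < g := by positivity
  have hmeasCost : ∀ (t s : ℕ) (j : Fin K), Measurable fun h : Fin t → Fin K × I × ℝ =>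
      A.policy t (observed h) {j} * playCost c r g (m j) (observed h) j s := by
    intro t s j
    refine (measurable_policy A t j).mul (Measurable.ite
      (measurableSet_eq_fun ((measurable_pulls j).comp measurable_observed) measurable_const)
      ?_ measurable_const)
    have : Measurable fun h : Fin t → Fin K × I × ℝ => deviation (m j) (observed h) j :=
      (measurable_deviation (m j) j).comp measurable_observed
    fun_prop
  have hround : ∀ t ∈ Finset.range T,
      ∫⁻ h, ∑ j, A.policy t (observed h) {j} * ENNReal.ofReal (b - m j) ∂(cabLaw A π ν t) ≤
      (∑ j, ∑ s ∈ Finset.range T, ∫⁻ h, A.policy t (observed h) {j} *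
        playCost c r g (m j) (observed h) j s ∂(cabLaw A π ν t)) + ENNReal.ofReal (4 / √r) := by
    intro t ht
    refine (lintegral_mono fun h => sum_policy_mul_gap_le hA (Finset.mem_range.1 ht) hb hm i
      g g (observed h)).trans ?_
    simp only [Finset.mul_sum]
    rw [lintegral_add_left (Finset.measurable_sum _ fun j _ =>
        Finset.measurable_sum _ fun s _ => hmeasCost t s j),
      lintegral_finsetSum _ fun j _ => Finset.measurable_sum _ fun s _ => hmeasCost t s j]
    simp only [lintegral_finsetSum _ fun s (_ : s ∈ Finset.range T) => hmeasCost t s _]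
    refine add_le_add le_rfl ?_
    rw [lintegral_add_right _ measurable_const, lintegral_const, measure_univ, mul_one]
    calc _ ≤ ENNReal.ofReal (2 / √r) + ENNReal.ofReal (g + g) :=
          add_le_add (lintegral_underestimation_le hunder hc hr0 t) le_rfl
      _ = ENNReal.ofReal (4 / √r) := by
          rw [← ENNReal.ofReal_add (by positivity) (by positivity)]
          congr 1
          rw [hg]; ring
  have harm : ∀ j, ∑ s ∈ Finset.range T, ∑ t ∈ Finset.range T,
      ∫⁻ h, A.policy t (observed h) {j} * playCost c r g (m j) (observed h) j s ∂(cabLaw A π ν t) ≤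
      ENNReal.ofReal (1 + 5 * √r) := by
    intro j
    refine (Finset.sum_le_sum fun s _ =>
      sum_lintegral_playCost_le (A := A) (hover j) c r g s T).trans ?_
    have hbn : ∀ s, 0 ≤ bonus c r s := fun s => Real.sqrt_nonneg _
    rw [← ENNReal.ofReal_sum_of_nonneg fun s _ => by
      have := hbn s
      positivity]
    refine ENNReal.ofReal_le_ofReal ?_
    rw [Finset.sum_add_distrib, Finset.sum_add_distrib]
    have h1 : ∑ s ∈ Finset.range T, (if s = 0 then (1 : ℝ) else 0) ≤ 1 := by
      rw [Finset.sum_ite_eq']; split_ifs <;> norm_num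
    have h2 := sum_bonus_le hc' hr0 T
    have h3 := sum_exp_neg_sqrt_div_le hg0 T
    have h4 : 1 / g = √r := by rw [hg, one_div_one_div]
    linarith
  calc _ ≤ ∑ t ∈ Finset.range T, ((∑ j, ∑ s ∈ Finset.range T, ∫⁻ h, A.policy t (observed h) {j} *
        playCost c r g (m j) (observed h) j s ∂(cabLaw A π ν t)) + ENNReal.ofReal (4 / √r)) :=
        Finset.sum_le_sum hround
    _ = (∑ j, ∑ s ∈ Finset.range T, ∑ t ∈ Finset.range T, ∫⁻ h, A.policy t (observed h) {j} *
        playCost c r g (m j) (observed h) j s ∂(cabLaw A π ν t)) +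
          T * ENNReal.ofReal (4 / √r) := by
        rw [Finset.sum_add_distrib, Finset.sum_comm]
        congr 1
        · exact Finset.sum_congr rfl fun j _ => Finset.sum_comm
        · simp
    _ ≤ (∑ _j : Fin K, ENNReal.ofReal (1 + 5 * √r)) + T * ENNReal.ofReal (4 / √r) := by
        gcongr with j _
        exact harm j
    _ = ENNReal.ofReal (K * (1 + 5 * √r) + T * (4 / √r)) := by
        rw [ENNReal.ofReal_add (p := K * (1 + 5 * √r)) (by positivity) (by positivity),
          ENNReal.ofReal_mul hK0.le,
          ENNReal.ofReal_mul hT0.le]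
        simp
    _ ≤ _ := by
        refine ENNReal.ofReal_le_ofReal ?_
        have h1 : K * √r = √(K * T) := by
          rw [hr, Real.sqrt_div hT0.le, Real.sqrt_mul hK0.le, ← mul_div_assoc, mul_div_right_comm,
            Real.div_sqrt]
        have h2 : T / √r = √(K * T) := by
          rw [← h1, div_eq_iff hsr.ne', mul_assoc, Real.mul_self_sqrt hr0.le, hr]
          field_simp
        have h3 : (K : ℝ) ≤ √(K * T) := Real.le_sqrt_of_sq_le (by nlinarith)
        have h4 : T * (4 / √r) = 4 * (T / √r) := by ring
        rw [h4, h2]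
        linarith

end Moss

/-! ### Cells as arms: tails, moments and means of their rewards -/

section Arms

variable {f : I → ℝ} {ν : ℕ → Kernel I ℝ} {K : ℕ} {π : Fin K → Measure I}

lemma measurableSet_cell (K : ℕ) (i : Fin K) :
    MeasurableSet {x : I | (i : ℝ) / K ≤ (x : ℝ) ∧ (x : ℝ) ≤ ((i : ℝ) + 1) / K} :=
  (measurableSet_le measurable_const measurable_subtype_coe).inter
    (measurableSet_le measurable_subtype_coe measurable_const)

instance isProbabilityMeasure_uniformCell (K : ℕ) (i : Fin K) :
    IsProbabilityMeasure (uniformCell K i) := by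
  have hK : (0 : ℝ) < K := by exact_mod_cast i.pos
  have hi : ((i : ℕ) : ℝ) + 1 ≤ K := by exact_mod_cast i.isLt
  refine cond_isProbabilityMeasure ?_
  set a : I := ⟨(i : ℝ) / K, by positivity, by rw [div_le_one hK]; linarith⟩ with ha
  set b : I := ⟨((i : ℝ) + 1) / K, by positivity, by rw [div_le_one hK]; exact hi⟩ with hb
  have hset : {x : I | (i : ℝ) / K ≤ (x : ℝ) ∧ (x : ℝ) ≤ ((i : ℝ) + 1) / K} = Set.Icc a b := by
    ext x
    simp [ha, hb, ← Subtype.coe_le_coe]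
  rw [hset, unitInterval.volume_Icc, Ne, ENNReal.ofReal_eq_zero, not_le, sub_pos]
  exact div_lt_div_of_pos_right (by linarith) hK

lemma ae_mem_uniformCell (K : ℕ) (i : Fin K) :
    ∀ᵐ x : I ∂(uniformCell K i), (i : ℝ) / K ≤ (x : ℝ) ∧ (x : ℝ) ≤ ((i : ℝ) + 1) / K :=
  ae_cond_mem (measurableSet_cell K i)

lemma exists_mem_cell (hK : 0 < K) (x : I) :
    ∃ i : Fin K, (i : ℝ) / K ≤ (x : ℝ) ∧ (x : ℝ) ≤ ((i : ℝ) + 1) / K := by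
  have hK' : (0 : ℝ) < K := by exact_mod_cast hK
  have hx := x.2
  rcases lt_or_eq_of_le hx.2 with h1 | h1
  · have hx0 : 0 ≤ K * (x : ℝ) := mul_nonneg hK'.le hx.1
    refine ⟨⟨⌊K * (x : ℝ)⌋₊, (Nat.floor_lt hx0).2 (by nlinarith)⟩, ?_, ?_⟩
    · rw [div_le_iff₀ hK', mul_comm (x : ℝ)]
      exact Nat.floor_le hx0
    · rw [le_div_iff₀ hK', mul_comm (x : ℝ)]
      exact (Nat.lt_floor_add_one _).le
  · have hcast : ((K - 1 : ℕ) : ℝ) = K - 1 := by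
      rw [Nat.cast_sub hK]; norm_num
    refine ⟨⟨K - 1, by omega⟩, ?_, ?_⟩ <;> simp only [hcast, h1]
    · rw [div_le_one hK']; linarith
    · rw [sub_add_cancel, div_self hK'.ne']

/-- The Hölder condition holds at one point only and does not give measurability; it comes from f
being the mean of a kernel. -/
lemma IsRewardModel.measurable (hν : IsRewardModel f ν) : Measurable f := by
  have := hν.markov 0
  have h : f = fun x => ∫ y, y ∂(ν 0 x) := funext fun x => (hν.mean 0 x).symm
  rw [h]
  exact (stronglyMeasurable_id.integral_kernel (κ := ν 0)).measurable

lemma lintegral_exp_le_of_hasSubgaussianMGF {Ω : Type*} [MeasurableSpace Ω] {μ : Measure Ω}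
    {X : Ω → ℝ} {v : ℝ≥0} (h : HasSubgaussianMGF X v μ) (l : ℝ) :
    ∫⁻ w, ENNReal.ofReal (Real.exp (l * X w)) ∂μ ≤ ENNReal.ofReal (Real.exp (l ^ 2 * v / 2)) := by
  rw [← ofReal_integral_eq_lintegral_ofReal (h.integrable_exp_mul l)
    (Filter.Eventually.of_forall fun _ => (Real.exp_pos _).le)]
  refine ENNReal.ofReal_le_ofReal ((h.mgf_le l).trans (le_of_eq ?_))
  rw [mul_comm (v : ℝ)]

lemma IsRewardModel.lintegral_exp_le (hν : IsRewardModel f ν) (t : ℕ) (x : I) (l : ℝ) :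
    ∫⁻ y, ENNReal.ofReal (Real.exp (l * (y - f x))) ∂(ν t x) ≤
      ENNReal.ofReal (Real.exp (l ^ 2 * (1 / 4) / 2)) := by
  simpa using lintegral_exp_le_of_hasSubgaussianMGF (hν.subgaussian t x) l

variable [hπ : ∀ i, IsProbabilityMeasure (π i)] [hm : ∀ t, IsMarkovKernel (ν t)]

/-- The rewards of an arm whose mean-payoffs are at least `b` have sub-Gaussian lower tails around
`b`. -/
lemma IsRewardModel.lintegral_exp_armLaw_le_of_le (hν : IsRewardModel f ν) {b : ℝ} {i : Fin K}
    (hb : ∀ᵐ x ∂(π i), b ≤ f x) (t : ℕ) {l : ℝ} (hl : l ≤ 0) :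
    ∫⁻ w, ENNReal.ofReal (Real.exp (l * (w.2 - b))) ∂(armLaw π ν t i) ≤
      ENNReal.ofReal (Real.exp (l ^ 2 * (1 / 4) / 2)) := by
  rw [armLaw, Measure.lintegral_compProd (by fun_prop)]
  calc _ ≤ ∫⁻ _, ENNReal.ofReal (Real.exp (l ^ 2 * (1 / 4) / 2)) ∂(π i) := by
        refine lintegral_mono_ae ?_
        filter_upwards [hb] with x hx
        refine le_trans (lintegral_mono fun y => ?_) (hν.lintegral_exp_le t x l)
        refine ENNReal.ofReal_le_ofReal (Real.exp_le_exp.2 ?_)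
        nlinarith
    _ = _ := by simp

/-- The rewards of any arm are `1 / 2`-sub-Gaussian around the mean of the arm. -/
lemma IsRewardModel.lintegral_exp_armLaw_le (hν : IsRewardModel f ν)
    (hf : ∀ x, f x ∈ Set.Icc (0 : ℝ) 1) (i : Fin K) (t : ℕ) (l : ℝ) :
    ∫⁻ w, ENNReal.ofReal (Real.exp (l * (w.2 - ∫ x, f x ∂(π i)))) ∂(armLaw π ν t i) ≤
      ENNReal.ofReal (Real.exp (l ^ 2 * (1 / 2) / 2)) := by
  set m := ∫ x, f x ∂(π i)
  have hfm := hν.measurable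
  -- Hoeffding's lemma: the payoff at a random point of the cell has proxy 1/4, which adds to the
  -- 1/4 of the noise.
  have hsub : HasSubgaussianMGF (fun x => f x - m) ((‖(1 : ℝ) - 0‖₊ / 2) ^ 2) (π i) :=
    hasSubgaussianMGF_of_mem_Icc hfm.aemeasurable (Filter.Eventually.of_forall hf)
  have hcell : ∫⁻ x, ENNReal.ofReal (Real.exp (l * (f x - m))) ∂(π i) ≤
      ENNReal.ofReal (Real.exp (l ^ 2 * (1 / 4) / 2)) := by
    refine (lintegral_exp_le_of_hasSubgaussianMGF hsub l).trans (le_of_eq ?_)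
    congr 4
    norm_num
  rw [armLaw, Measure.lintegral_compProd (by fun_prop)]
  calc _ ≤ ∫⁻ x, ENNReal.ofReal (Real.exp (l * (f x - m))) *
        ENNReal.ofReal (Real.exp (l ^ 2 * (1 / 4) / 2)) ∂(π i) := by
        refine lintegral_mono fun x => ?_
        dsimp only
        have : ∀ y : ℝ, ENNReal.ofReal (Real.exp (l * (y - m))) =
            ENNReal.ofReal (Real.exp (l * (f x - m))) *
              ENNReal.ofReal (Real.exp (l * (y - f x))) := by
          intro y
          rw [← ENNReal.ofReal_mul (Real.exp_pos _).le, ← Real.exp_add]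
          congr 2
          ring
        rw [lintegral_congr this, lintegral_const_mul _ (by fun_prop)]
        gcongr
        exact hν.lintegral_exp_le t x l
    _ ≤ ENNReal.ofReal (Real.exp (l ^ 2 * (1 / 4) / 2)) *
        ENNReal.ofReal (Real.exp (l ^ 2 * (1 / 4) / 2)) := by
        rw [lintegral_mul_const _ (by fun_prop)]
        gcongr
    _ = _ := by
        rw [← ENNReal.ofReal_mul (Real.exp_pos _).le, ← Real.exp_add]
        congr 2
        ring

lemma IsRewardModel.lintegral_enorm_armLaw_le (hν : IsRewardModel f ν)
    (hf : ∀ x, f x ∈ Set.Icc (0 : ℝ) 1) (i : Fin K) (t : ℕ) :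
    ∫⁻ w, ‖w.2‖ₑ ∂(armLaw π ν t i) ≤ 1 + 2 * ENNReal.ofReal (Real.exp (1 / 4 / 2)) := by
  rw [armLaw, Measure.lintegral_compProd (by fun_prop)]
  refine (lintegral_mono (g := fun _ => 1 + 2 * ENNReal.ofReal (Real.exp (1 / 4 / 2)))
    fun x => ?_).trans (by simp)
  dsimp only
  have h1 := hν.lintegral_exp_le t x 1
  have h2 := hν.lintegral_exp_le t x (-1)
  norm_num at h1 h2
  calc ∫⁻ y, ‖y‖ₑ ∂(ν t x)
      ≤ ∫⁻ y, (1 + (ENNReal.ofReal (Real.exp (y - f x)) + ENNReal.ofReal (Real.exp (f x - y))))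
        ∂(ν t x) := by
        refine lintegral_mono fun y => ?_
        rw [← ofReal_norm, ← ENNReal.ofReal_one,
          ← ENNReal.ofReal_add (Real.exp_pos _).le (Real.exp_pos _).le,
          ← ENNReal.ofReal_add zero_le_one (by positivity)]
        refine ENNReal.ofReal_le_ofReal (abs_le.2 ⟨?_, ?_⟩)
        · linarith [Real.add_one_le_exp (f x - y), Real.exp_pos (y - f x), (hf x).1]
        · linarith [Real.add_one_le_exp (y - f x), Real.exp_pos (f x - y), (hf x).2]
    _ ≤ 1 + (ENNReal.ofReal (Real.exp (1 / 4 / 2)) + ENNReal.ofReal (Real.exp (1 / 4 / 2))) := by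
        rw [lintegral_add_left (by fun_prop), lintegral_add_left (by fun_prop)]
        norm_num
        gcongr
    _ = _ := by rw [two_mul]

lemma IsRewardModel.integral_armLaw (hν : IsRewardModel f ν)
    (hf : ∀ x, f x ∈ Set.Icc (0 : ℝ) 1) (i : Fin K) (t : ℕ) :
    ∫ w, w.2 ∂(armLaw π ν t i) = ∫ x, f x ∂(π i) := by
  have hint : Integrable (fun w : I × ℝ => w.2) (π i ⊗ₘ ν t) :=
    ⟨measurable_snd.aestronglyMeasurable,
      (hν.lintegral_enorm_armLaw_le (π := π) hf i t).trans_lt (by finiteness)⟩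
  rw [armLaw, Measure.integral_compProd hint]
  simp only [hν.mean]

end Arms

/-! ### The balancing scale -/

section Parameters

variable {L α : ℝ} {T : ℕ}

/-- The scale is (L√T)^(2/(2α+1)). Being above 1, it is at most doubled by rounding up. -/
lemma one_lt_cellScale (hT : 1 ≤ T) (hα : 0 < α) (hL : 1 / √(T : ℝ) < L) :
    1 < L ^ (2 / (2 * α + 1)) * (T : ℝ) ^ (1 / (2 * α + 1)) := by
  have hT0 : (0 : ℝ) < T := by exact_mod_cast hT
  have hs : 0 < √(T : ℝ) := Real.sqrt_pos.2 hT0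
  have hL0 : 0 < L := lt_trans (by positivity) hL
  have h1 : 1 < L * √(T : ℝ) := by rwa [div_lt_iff₀ hs] at hL
  have h2 : L ^ (2 / (2 * α + 1)) * (T : ℝ) ^ (1 / (2 * α + 1)) =
      (L * √(T : ℝ)) ^ (2 / (2 * α + 1)) := by
    rw [Real.mul_rpow hL0.le hs.le, Real.sqrt_eq_rpow, ← Real.rpow_mul hT0.le]
    congr 2
    ring
  rw [h2]
  exact Real.one_lt_rpow h1 (by positivity)

lemma sqrt_cellScale_mul (hL : 0 < L) (hT : 1 ≤ T) (hα : 0 < α) :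
    √(L ^ (2 / (2 * α + 1)) * (T : ℝ) ^ (1 / (2 * α + 1)) * T) =
      L ^ (1 / (2 * α + 1)) * (T : ℝ) ^ ((α + 1) / (2 * α + 1)) := by
  have hT0 : (0 : ℝ) < T := by exact_mod_cast hT
  rw [Real.sqrt_eq_iff_eq_sq (by positivity) (by positivity), mul_pow, ← Real.rpow_mul_natCast hL.le,
    ← Real.rpow_mul_natCast hT0.le, mul_assoc]
  nth_rewrite 2 [← Real.rpow_one (T : ℝ)]
  rw [← Real.rpow_add hT0]
  congr 2
  · push_cast; ring
  · push_cast; field_simp; ring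

lemma mul_cellScale_rpow_neg (hL : 0 < L) (hT : 1 ≤ T) (hα : 0 < α) :
    T * (L * (L ^ (2 / (2 * α + 1)) * (T : ℝ) ^ (1 / (2 * α + 1))) ^ (-α)) =
      L ^ (1 / (2 * α + 1)) * (T : ℝ) ^ ((α + 1) / (2 * α + 1)) := by
  have hT0 : (0 : ℝ) < T := by exact_mod_cast hT
  rw [Real.mul_rpow (by positivity) (by positivity), ← Real.rpow_mul hL.le, ← Real.rpow_mul hT0.le]
  have h1 : L ^ (1 / (2 * α + 1)) = L * L ^ (2 / (2 * α + 1) * -α) := by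
    nth_rewrite 2 [← Real.rpow_one L]
    rw [← Real.rpow_add hL]
    congr 1
    field_simp
    ring
  have h2 : (T : ℝ) ^ ((α + 1) / (2 * α + 1)) = T * (T : ℝ) ^ (1 / (2 * α + 1) * -α) := by
    nth_rewrite 2 [← Real.rpow_one (T : ℝ)]
    rw [← Real.rpow_add hT0]
    congr 1
    field_simp
    ring
  rw [h1, h2]
  ring

end Parameters

/-! ### Regret of CAB1.1 on a given number of cells -/

section Regret

variable {f : I → ℝ} {ν : ℕ → Kernel I ℝ} {K : ℕ} {π : Fin K → Measure I}

lemma integral_payoff_nonneg (hf : ∀ x, f x ∈ Set.Icc (0 : ℝ) 1) (j : Fin K) :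
    0 ≤ ∫ x, f x ∂(π j) := integral_nonneg fun x => (hf x).1

variable  [hπ : ∀ i, IsProbabilityMeasure (π i)]

lemma IsRewardModel.ofReal_regret_le (hν : IsRewardModel f ν)
    (hf : ∀ x, f x ∈ Set.Icc (0 : ℝ) 1) (A : FiniteAlgorithm K) (b : ℝ) (T : ℕ) :
    ENNReal.ofReal (T * b - ∫ h, ∑ s, (h s).2.2 ∂(cabLaw A π ν T)) ≤
      ∑ t ∈ Finset.range T, ∫⁻ h, ∑ j, A.policy t (observed h) {j} *
        ENNReal.ofReal (b - ∫ x, f x ∂(π j)) ∂(cabLaw A π ν t) := by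
  have := hν.markov
  exact CAB.ofReal_regret_le (C := 1 + 2 * ENNReal.ofReal (Real.exp (1 / 4 / 2))) (by finiteness)
    (fun t j => hν.lintegral_enorm_armLaw_le hf j t) (fun t j => hν.integral_armLaw hf j t) b T

lemma IsRewardModel.cabRegret_le_horizon (hν : IsRewardModel f ν)
    (hf : ∀ x, f x ∈ Set.Icc (0 : ℝ) 1) (A : FiniteAlgorithm K) (T : ℕ) :
    cabRegret A π f ν T ≤ T := by
  have := hν.markov
  have hM : ⨆ x, f x ≤ 1 := ciSup_le fun x => (hf x).2
  have h := hν.ofReal_regret_le (π := π) hf A (⨆ x, f x) T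
  have hbound : ∑ t ∈ Finset.range T, ∫⁻ h, ∑ j, A.policy t (observed h) {j} *
        ENNReal.ofReal ((⨆ x, f x) - ∫ x, f x ∂(π j)) ∂(cabLaw A π ν t) ≤
      ENNReal.ofReal T := by
    calc _ ≤ ∑ t ∈ Finset.range T, ∫⁻ _, 1 ∂(cabLaw A π ν t) := by
          refine Finset.sum_le_sum fun t _ => lintegral_mono fun h => ?_
          dsimp only
          rw [← sum_policy A t h]
          refine Finset.sum_le_sum fun j _ => mul_le_of_le_one_right' ?_
          rw [ENNReal.ofReal_le_one]
          linarith [integral_payoff_nonneg (π := π) hf j]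
      _ = _ := by simp
  exact (ENNReal.ofReal_le_ofReal_iff (by positivity)).1 (h.trans hbound)

/-- Regret of CAB1.1 run with MOSS on `K` regular cells. -/
lemma IsRewardModel.cabRegret_uniformCell_moss_le (hν : IsRewardModel f ν) {L α : ℝ}
    (hf : f ∈ holderClass L α) (hL : 0 ≤ L) (hα : 0 < α) {c : ℝ} (hc : 1 / 2 ≤ c) (hc' : c ≤ 1)
    {T : ℕ} (hK : 0 < K) (hKT : K ≤ T) {A : FiniteAlgorithm K} (hA : IsMOSS c T A) :
    cabRegret A (uniformCell K) f ν T ≤ T * (L * (K : ℝ) ^ (-α)) + 10 * √(K * T) := by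
  have := hν.markov
  have : NeZero K := ⟨hK.ne'⟩
  have hK0 : (0 : ℝ) < K := by exact_mod_cast hK
  obtain ⟨hf01, xs, hxs, hhol⟩ := hf
  obtain ⟨i, hi1, hi2⟩ := exists_mem_cell hK xs
  set b := (⨆ x, f x) - L * (K : ℝ) ^ (-α) with hb
  have hb1 : b ≤ 1 := by
    have h1 : ⨆ x, f x ≤ 1 := hxs ▸ (hf01 xs).2
    have h2 : 0 ≤ L * (K : ℝ) ^ (-α) := by positivity
    linarith
  have hcell : ∀ᵐ x ∂(uniformCell K i), b ≤ f x := by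
    filter_upwards [ae_mem_uniformCell K i] with x hx
    have hdist : |(xs : ℝ) - x| ≤ 1 / K := by
      have : ((i : ℝ) + 1) / K = i / K + 1 / K := add_div _ _ _
      rw [abs_le]
      constructor <;> linarith [hx.1, hx.2]
    have hpow : |(xs : ℝ) - x| ^ α ≤ (K : ℝ) ^ (-α) := by
      refine (Real.rpow_le_rpow (abs_nonneg _) hdist hα.le).trans (le_of_eq ?_)
      rw [one_div, Real.inv_rpow hK0.le, Real.rpow_neg hK0.le]
    have h1 := (le_abs_self _).trans (hhol x)
    have h2 := mul_le_mul_of_nonneg_left hpow hL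
    rw [hb, ← hxs]
    linarith
  have hmoss := sum_lintegral_gap_moss_le (A := A) (π := uniformCell K) (ν := ν) hc hc' hKT hA hb1
    (fun j => integral_payoff_nonneg (π := uniformCell K) hf01 j)
    (fun j t l _ => hν.lintegral_exp_armLaw_le hf01 j t l) i
    (fun t l hl => hν.lintegral_exp_armLaw_le_of_le hcell t hl)
  have hreg := (ENNReal.ofReal_le_ofReal_iff (by positivity)).1
    ((hν.ofReal_regret_le (π := uniformCell K) hf01 A b T).trans hmoss)
  have : cabRegret A (uniformCell K) f ν T = T * (L * (K : ℝ) ^ (-α)) +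
      (T * b - ∫ h, ∑ s, (h s).2.2 ∂(cabLaw A (uniformCell K) ν T)) := by
    rw [cabRegret, hb]; ring
  rw [this]
  linarith

end Regret

end CAB

/-! ### Conclusion with the optimal number of cells -/

theorem proposition2 (T : ℕ) (hT : 1 ≤ T) (α L : ℝ) (hα : 0 < α) (hL : 1 / √(T : ℝ) < L)
    (c : ℝ) (hc : c = 1 / 2 ∨ c = 1)
    (A : CAB.FiniteAlgorithm (CAB.cellCount L α T)) (hA : CAB.IsMOSS c T A)
    (f : unitInterval → ℝ) (hf : f ∈ CAB.holderClass L α)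
    (ν : ℕ → ProbabilityTheory.Kernel unitInterval ℝ) (hν : CAB.IsRewardModel f ν) :
    CAB.cabRegret A (CAB.uniformCell (CAB.cellCount L α T)) f ν T ≤
      28 * L ^ (1 / (2 * α + 1)) * (T : ℝ) ^ ((α + 1) / (2 * α + 1)) := by
  have hT0 : (0 : ℝ) < T := by exact_mod_cast hT
  have hL0 : 0 < L := lt_trans (by positivity) hL
  have hx1 := CAB.one_lt_cellScale hT hα hL
  have hsqrt := CAB.sqrt_cellScale_mul hL0 hT hα
  have happrox := CAB.mul_cellScale_rpow_neg hL0 hT hα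
  rw [mul_assoc 28]
  set B := L ^ (1 / (2 * α + 1)) * (T : ℝ) ^ ((α + 1) / (2 * α + 1))
  set x := L ^ (2 / (2 * α + 1)) * (T : ℝ) ^ (1 / (2 * α + 1)) with hx
  have hB0 : 0 ≤ B := by positivity
  by_cases hxT : (T : ℝ) ≤ x
  -- B² = xT ≥ T².
  · have hTB : (T : ℝ) ≤ B := by
      rw [← hsqrt]
      exact Real.le_sqrt_of_sq_le (by nlinarith)
    linarith [hν.cabRegret_le_horizon (π := CAB.uniformCell (CAB.cellCount L α T)) hf.1 A T]
  · have hK : CAB.cellCount L α T = ⌈x⌉₊ :=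
      min_eq_left (Nat.ceil_le.2 (not_le.1 hxT).le)
    have hKpos : 0 < CAB.cellCount L α T := by
      rw [hK]; exact Nat.ceil_pos.2 (by linarith)
    have hxK : x ≤ (CAB.cellCount L α T : ℝ) := by
      rw [hK]; exact Nat.le_ceil x
    have hKx : (CAB.cellCount L α T : ℝ) ≤ 2 * x := by
      rw [hK]; linarith [Nat.ceil_lt_add_one (by linarith : 0 ≤ x)]
    have hmain := hν.cabRegret_uniformCell_moss_le hf hL0.le hα
      (by rcases hc with h | h <;> rw [h]; norm_num) (by rcases hc with h | h <;> rw [h]; norm_num)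
      hKpos (min_le_right _ _) hA
    have h1 : T * (L * (CAB.cellCount L α T : ℝ) ^ (-α)) ≤ B := by
      rw [← happrox]
      refine mul_le_mul_of_nonneg_left (mul_le_mul_of_nonneg_left ?_ hL0.le) hT0.le
      exact Real.rpow_le_rpow_of_nonpos (by linarith) hxK (by linarith)
    -- From K ≤ 2x and √2 ≤ 3/2; the total is then B + 15 B.
    have h2 : √((CAB.cellCount L α T : ℝ) * T) ≤ 3 / 2 * B := by
      rw [← hsqrt, Real.sqrt_le_left (by positivity), mul_pow, Real.sq_sqrt (by positivity)]
      nlinarith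
    linarith
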